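/- All graphs are finite and simple. For a graph $G$ on $n$ vertices let $S(G)$ be the set of real symmetric matrices $A=[a_{ij}]$, indexed by the vertices of $G$, such that for $i\neq j$ the entry $a_{ij}$ is nonzero if and only if $ij$ is an edge of $G$ (the diagonal entries are arbitrary), and let $I(G)=\{(\pi(A),\nu(A)) : A\in S(G)\}$, where $\pi(A)$ and $\nu(A)$ are the numbers of positive and of negative eigenvalues of $A$, counted with multiplicity. For integers $k\ge 0$, $m$, $N$ put $$T^k_{[m,N]}=\{(r,s)\in\mathbb{Z}_{\ge 0}^2 : r\ge k,\ s\ge k,\ m\le r+s\le N\},\qquad T_{[m,N]}=T^0_{[m,N]}.$$ The join $F\oplus_v H$ of two graphs that have exactly the vertex $v$ in common is the union of $F$ and $H$. For integers $\alpha,\beta\ge 0$, a supernova with center $v$, $\alpha$ cycles and $\beta$ pendant paths is a graph obtained by joining at the common vertex $v$, with no other vertices in common, $\alpha$ cycles (each of length at least $3$) and $\beta$ paths that have $v$ as an endpoint (each with at least one vertex besides $v$); it is the single vertex $v$ if $\alpha=\beta=0$. A pulsar is a graph $G=S_1\oplus_v C\oplus_u S_2$, where $C$ is a cycle, $v$ and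 $u$ are distinct vertices of $C$ that are not adjacent, and $S_1$, $S_2$ are supernovas with centers $v$ and $u$ respectively. **Theorem 5.1.** Let $G$ be a pulsar on $n$ vertices whose two supernovas $S_1$ and $S_2$ have $\alpha_1$ cycles and $\beta_1$ pendant paths, and $\alpha_2$ cycles and $\beta_2$ pendant paths, respectively. Then $$I(G)=T_{[n-\alpha_1-\alpha_2-2,\,n]}\cup T^1_{[n-\alpha_1-\alpha_2-\beta_1,\,n]}\cup T^1_{[n-\alpha_1-\alpha_2-\beta_2,\,n]}\cup T^2_{[n-\alpha_1-\alpha_2-\beta_1-\beta_2,\,n]}.$$ -/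

import Mathlib

/-- `A` is supported on the pattern of `G`: off the diagonal, the entry `(i, j)` is nonzero exactly
when `i` and `j` are adjacent. The diagonal entries are unrestricted. -/
def HasGraphPattern {V : Type*} (G : SimpleGraph V) (A : Matrix V V ℝ) : Prop :=
  ∀ i j, i ≠ j → (A i j ≠ 0 ↔ G.Adj i j)

/-- The number of positive eigenvalues of a real symmetric matrix, with multiplicity
(over `ℝ`, Hermitian means symmetric). -/
noncomputable def posEigenvalueCount {V : Type*} [Fintype V] [DecidableEq V]
    {A : Matrix V V ℝ} (hA : A.IsHermitian) : ℕ :=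
  (Finset.univ.filter fun i => 0 < hA.eigenvalues i).card

/-- The number of negative eigenvalues of a real symmetric matrix, with multiplicity. -/
noncomputable def negEigenvalueCount {V : Type*} [Fintype V] [DecidableEq V]
    {A : Matrix V V ℝ} (hA : A.IsHermitian) : ℕ :=
  (Finset.univ.filter fun i => hA.eigenvalues i < 0).card

/-- The inertia table `I(G)`: all partial inertias `(π(A), ν(A))` of the real symmetric matrices `A`
with the pattern of `G`. -/
def inertiaTable {V : Type*} [Fintype V] [DecidableEq V] (G : SimpleGraph V) : Set (ℕ × ℕ) :=
  {q | ∃ (A : Matrix V V ℝ) (hA : A.IsHermitian), HasGraphPattern G A ∧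
    q = (posEigenvalueCount hA, negEigenvalueCount hA)}

/-- The set `T^k_[m,n]`: the points with rank between `m` and `n`, inset by `k` from the axes.
The bounds are integers so that differences of sizes can be written without truncation. -/
def trapezoid (k : ℕ) (m n : ℤ) : Set (ℕ × ℕ) :=
  {q | k ≤ q.1 ∧ k ≤ q.2 ∧ m ≤ (q.1 : ℤ) + (q.2 : ℤ) ∧ (q.1 : ℤ) + (q.2 : ℤ) ≤ n}

/-- `S` is the join `A ⊕_v B`: the union of `A` and `B`, which have exactly the vertex `v` in
common. -/
def IsJoinAt {V : Type*} {G : SimpleGraph V} (v : V) (A B S : G.Subgraph) : Prop :=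
  A.verts ∩ B.verts = {v} ∧ S = A ⊔ B

/-- `C` is a cycle `C_k`, with `k ≥ 3`. -/
def IsCycleSubgraph {V : Type*} {G : SimpleGraph V} (C : G.Subgraph) : Prop :=
  ∃ k : ℕ, 3 ≤ k ∧ Nonempty (C.coe ≃g SimpleGraph.cycleGraph k)

/-- `P` is a path on at least two vertices, one of whose endpoints is `v`; thus `P` without `v` is
a nonempty path hanging from `v`. -/
def IsPathFrom {V : Type*} {G : SimpleGraph V} (v : V) (P : G.Subgraph) : Prop :=
  ∃ (k : ℕ) (e : P.coe ≃g SimpleGraph.pathGraph (k + 2)) (hv : v ∈ P.verts), e ⟨v, hv⟩ = 0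

/-- `S` is a generalized star with center `v`: `p` paths joined at their common endpoint `v`
(the single vertex `v` if `p = 0`). -/
def IsGeneralizedStar {V : Type*} {G : SimpleGraph V} (v : V) (p : ℕ) (S : G.Subgraph) : Prop :=
  ∃ P : Fin p → G.Subgraph, (∀ i, IsPathFrom v (P i)) ∧
    (∀ i j, i ≠ j → (P i).verts ∩ (P j).verts = {v}) ∧
    S = G.singletonSubgraph v ⊔ ⨆ i, P i

/-- `S` is a bouquet with center `v`: `k` cycles joined at their common vertex `v`
(the single vertex `v` if `k = 0`). -/
def IsBouquet {V : Type*} {G : SimpleGraph V} (v : V) (k : ℕ) (S : G.Subgraph) : Prop :=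
  ∃ C : Fin k → G.Subgraph, (∀ i, IsCycleSubgraph (C i) ∧ v ∈ (C i).verts) ∧
    (∀ i j, i ≠ j → (C i).verts ∩ (C j).verts = {v}) ∧
    S = G.singletonSubgraph v ⊔ ⨆ i, C i

/-- `S` is a supernova with center `v`, `α` cycles and `β` pendant paths: a generalized star and a
bouquet, both with center `v`, joined at `v`. -/
def IsSupernova {V : Type*} {G : SimpleGraph V} (v : V) (α β : ℕ) (S : G.Subgraph) : Prop :=
  ∃ A B : G.Subgraph, IsGeneralizedStar v β A ∧ IsBouquet v α B ∧ IsJoinAt v A B S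

/-- `G` is a pulsar `S₁ ⊕_v C ⊕_u S₂`: two supernovas `S₁` and `S₂` with centers `v` and `u`, having
`α₁` cycles and `β₁` pendant paths, and `α₂` cycles and `β₂` pendant paths, and a cycle `C` on which
`v` and `u` are distinct and not adjacent. -/
def IsPulsar {V : Type*} (G : SimpleGraph V) (α₁ β₁ α₂ β₂ : ℕ) : Prop :=
  ∃ (v u : V) (S₁ C S₂ K : G.Subgraph),
    IsSupernova v α₁ β₁ S₁ ∧ IsSupernova u α₂ β₂ S₂ ∧ IsCycleSubgraph C ∧
    v ∈ C.verts ∧ u ∈ C.verts ∧ v ≠ u ∧ ¬ C.Adj v u ∧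
    IsJoinAt v S₁ C K ∧ IsJoinAt u K S₂ ⊤

/-!
Write `v`, `u` for the centers of the two supernovas and `α = α₁ + α₂`. Deleting `v` and `u`
leaves disjoint paths: one for each cycle and each pendant path of the supernovas, and two
*links*, the arcs of the central cycle between `v` and `u`. These paths are called arms.

**Every inertia lies in the union.** Since `π(A) + ν(A)` is `n` minus the nullity, the nullity has
to be bounded. A kernel vector that vanishes at the centers is determined on an arm by its value
at one end, because each equation along the arm gives the next value. Suppose that the principal
submatrix on a pendant arm at `v` is singular. A null vector of it, extended by zero, is isotropic
and is mapped to a nonzero multiple of the basis vector of `v`; hence `A` has eigenvalues of both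
signs, and kernel vectors vanish at `v`. A second singular arm attached to `u` gives an isotropic
plane, thus two eigenvalues of each sign, and kernel vectors vanish at both centers. On a
nonsingular arm, kernel vectors that vanish at the centers are zero. Counting the values that
still determine a kernel vector, where the equation at a center saves one pendant arm, bounds the
nullity by `α + 2`, by `α + β₁` or `α + β₂`, or by `α + β₁ + β₂`
(`ArmSystem.finrank_ker_le_of_nonsingular`, `ArmSystem.nullity_of_singular_pend`).

**Every point of the union is attained.** A diagonal perturbation of a singular matrix in the
support of a kernel vector adds one eigenvalue of a prescribed sign, so it is enough to find a
matrix with at most `r` positive and `s` negative eigenvalues (`mem_inertiaTable_of_le`). Such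
matrices are Gram matrices of vectors in the space of signature `(r, s)`, that is, signed sums of
squares of linear forms. The numbers of forms add up over edge-disjoint graphs, and the signs are
free. A graph with `m` edges needs `m` forms; a cycle on `k` vertices needs only `k - 2`, one for
each triangle of a fan triangulation whose diagonals cancel (`isFlexible_cycle`); and all edges at
a given vertex together are one hyperbolic plane, with one square of each sign
(`HasOrthRep.add_vertex`). Covering the edges at none, one or both of the centers by hyperbolic
planes and the remaining edges by the forms of the pieces gives the four sets
(`IsPulsarFamily.hasOrthRep`).
-/

open Matrix

/-! ### Inertia of real symmetric matrices -/

/-- In the coordinates with respect to an orthonormal eigenbasis the bilinear form of `A` is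
diagonal, with the eigenvalues as weights. -/
theorem exists_eigenCoordinates {V : Type*} [Fintype V] [DecidableEq V]
    {A : Matrix V V ℝ} (hA : A.IsHermitian) :
    ∃ c : (V → ℝ) ≃ₗ[ℝ] (V → ℝ), ∀ x y,
      x ⬝ᵥ (A *ᵥ y) = ∑ i, hA.eigenvalues i * (c x i * c y i) := by
  set U : Matrix V V ℝ := (hA.eigenvectorUnitary : Matrix V V ℝ) with hU
  have h1 : Uᵀ * U = 1 := by
    have := Unitary.coe_star_mul_self hA.eigenvectorUnitary
    simpa [star_eq_conjTranspose] using this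
  have h2 : U * Uᵀ = 1 := by
    have := Unitary.coe_mul_star_self hA.eigenvectorUnitary
    simpa [star_eq_conjTranspose] using this
  have h3 : A = U * diagonal hA.eigenvalues * Uᵀ := by
    conv_lhs => rw [hA.spectral_theorem]
    simp [Unitary.conjStarAlgAut_apply, star_eq_conjTranspose, hU]
  refine ⟨LinearEquiv.ofLinearMap (mulVecLin Uᵀ) (mulVecLin U) ?_ ?_, fun x y => ?_⟩
  · rw [← mulVecLin_mul, h1, mulVecLin_one]
  · rw [← mulVecLin_mul, h2, mulVecLin_one]
  · have h4 : x ⬝ᵥ (A *ᵥ y) = (Uᵀ *ᵥ x) ⬝ᵥ (diagonal hA.eigenvalues *ᵥ (Uᵀ *ᵥ y)) := by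
      conv_lhs => rw [h3]
      rw [← mulVec_mulVec, ← mulVec_mulVec, dotProduct_mulVec, ← mulVec_transpose]
    rw [h4, dotProduct]
    refine Finset.sum_congr rfl fun i _ => ?_
    simp only [LinearEquiv.coe_ofLinearMap, mulVecLin_apply, mulVec_diagonal]
    ring

/-- The number of positive weights of a diagonal quadratic form is at most the codimension of any
subspace on which the form is nonpositive. The subspace is given as the kernel of `L`. -/
theorem card_pos_le_of_nonpos_on_ker {V W : Type*} [Fintype V]
    [AddCommGroup W] [Module ℝ W] [FiniteDimensional ℝ W]
    (c : (V → ℝ) ≃ₗ[ℝ] (V → ℝ)) (l : V → ℝ) (L : (V → ℝ) →ₗ[ℝ] W)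
    (h : ∀ x, L x = 0 → ∑ i, l i * (c x i * c x i) ≤ 0) :
    (Finset.univ.filter fun i => 0 < l i).card ≤ Module.finrank ℝ W := by
  classical
  by_contra! hlt
  let E : ({i // 0 < l i} → ℝ) →ₗ[ℝ] (V → ℝ) :=
    Function.ExtendByZero.linearMap ℝ (Subtype.val : {i // 0 < l i} → V)
  have hE : ∀ z (i : {i // 0 < l i}), E z i = z i := fun z i => by
    simp [E]
  have hE0 : ∀ z (i : V), ¬ 0 < l i → E z i = 0 := fun z i hi => by
    simp only [E, Function.ExtendByZero.linearMap_apply]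
    rw [Function.extend_apply']
    · rfl
    · rintro ⟨a, rfl⟩
      exact hi a.2
  obtain ⟨z, hz, hz0⟩ := Submodule.exists_mem_ne_zero_of_ne_bot
    (LinearMap.ker_ne_bot_of_finrank_lt (f := L ∘ₗ c.symm.toLinearMap ∘ₗ E) (by
      rw [Module.finrank_fintype_fun_eq_card, Fintype.card_subtype]; exact hlt))
  have h1 := h (c.symm (E z)) (by simpa using hz)
  simp only [LinearEquiv.apply_symm_apply] at h1
  have hnn : ∀ i, 0 ≤ l i * (E z i * E z i) := fun i => by
    by_cases hi : 0 < l i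
    · exact mul_nonneg hi.le (mul_self_nonneg _)
    · simp [hE0 z i hi]
  have h2 : ∑ i, l i * (E z i * E z i) = 0 :=
    le_antisymm h1 (Finset.sum_nonneg fun i _ => hnn i)
  rw [Finset.sum_eq_zero_iff_of_nonneg fun i _ => hnn i] at h2
  apply hz0
  ext i
  have := h2 i (Finset.mem_univ _)
  rw [hE] at this
  simpa [i.2.ne'] using this

/-- A totally isotropic subspace that meets the radical trivially has dimension at most the number
of positive weights. The subspace is given as the range of `g`. -/
theorem le_card_pos_of_isotropic {V : Type*} [Fintype V] {d : ℕ}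
    (c : (V → ℝ) ≃ₗ[ℝ] (V → ℝ)) (l : V → ℝ) (g : (Fin d → ℝ) →ₗ[ℝ] (V → ℝ))
    (h0 : ∀ t, ∑ i, l i * (c (g t) i * c (g t) i) = 0)
    (h1 : ∀ t, (∀ i, l i * c (g t) i = 0) → t = 0) :
    d ≤ (Finset.univ.filter fun i => 0 < l i).card := by
  classical
  by_contra! hlt
  let R : (V → ℝ) →ₗ[ℝ] ({i // 0 < l i} → ℝ) :=
    LinearMap.funLeft ℝ ℝ (Subtype.val : {i // 0 < l i} → V)
  obtain ⟨t, ht, ht0⟩ := Submodule.exists_mem_ne_zero_of_ne_bot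
    (LinearMap.ker_ne_bot_of_finrank_lt (f := R ∘ₗ c.toLinearMap ∘ₗ g) (by
      rw [Module.finrank_fintype_fun_eq_card, Fintype.card_subtype]; simpa using hlt))
  have hz : ∀ i, 0 < l i → c (g t) i = 0 := fun i hi => congrFun ht ⟨i, hi⟩
  have hnn : ∀ i, l i * (c (g t) i * c (g t) i) ≤ 0 := fun i => by
    by_cases hi : 0 < l i
    · simp [hz i hi]
    · exact mul_nonpos_of_nonpos_of_nonneg (not_lt.1 hi) (mul_self_nonneg _)
  have h2 := h0 t
  rw [Finset.sum_eq_zero_iff_of_nonpos fun i _ => hnn i] at h2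
  refine ht0 (h1 t fun i => ?_)
  have := h2 i (Finset.mem_univ _)
  rcases mul_eq_zero.1 this with h | h
  · simp [h]
  · simp [mul_self_eq_zero.1 h]

/-- The nullity is at most the size of a set of coordinates that determines every kernel vector. -/
theorem finrank_ker_le_card_of_determining {V : Type*} [Fintype V]
    {A : Matrix V V ℝ} (T : Finset V)
    (h : ∀ y, A *ᵥ y = 0 → (∀ a ∈ T, y a = 0) → y = 0) :
    Module.finrank ℝ (LinearMap.ker A.mulVecLin) ≤ T.card := by
  let R : LinearMap.ker A.mulVecLin →ₗ[ℝ] (T → ℝ) :=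
    LinearMap.funLeft ℝ ℝ (Subtype.val : T → V) ∘ₗ (LinearMap.ker A.mulVecLin).subtype
  have hR : Function.Injective R := by
    rw [← LinearMap.ker_eq_bot, LinearMap.ker_eq_bot']
    intro y hy
    ext1
    exact h y y.2 fun a ha => congrFun hy ⟨a, ha⟩
  simpa using LinearMap.finrank_le_finrank_of_injective hR

section Inertia

variable {V : Type*} [Fintype V] [DecidableEq V] {A : Matrix V V ℝ}

theorem posEigenvalueCount_le_finrank {W : Type*} [AddCommGroup W] [Module ℝ W]
    [FiniteDimensional ℝ W] (hA : A.IsHermitian) (L : (V → ℝ) →ₗ[ℝ] W)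
    (h : ∀ x, L x = 0 → x ⬝ᵥ (A *ᵥ x) ≤ 0) : posEigenvalueCount hA ≤ Module.finrank ℝ W := by
  obtain ⟨c, hc⟩ := exists_eigenCoordinates hA
  exact card_pos_le_of_nonpos_on_ker c _ L fun x hx => (hc x x) ▸ h x hx

theorem negEigenvalueCount_le_finrank {W : Type*} [AddCommGroup W] [Module ℝ W]
    [FiniteDimensional ℝ W] (hA : A.IsHermitian) (L : (V → ℝ) →ₗ[ℝ] W)
    (h : ∀ x, L x = 0 → 0 ≤ x ⬝ᵥ (A *ᵥ x)) : negEigenvalueCount hA ≤ Module.finrank ℝ W := by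
  obtain ⟨c, hc⟩ := exists_eigenCoordinates hA
  have := card_pos_le_of_nonpos_on_ker c (fun i => -hA.eigenvalues i) L fun x hx => by
    simpa using (hc x x) ▸ h x hx
  simpa [negEigenvalueCount] using this

/-- A totally isotropic subspace, the range of `g`, that meets the kernel of `A` trivially forces as
many positive and as many negative eigenvalues as its dimension. -/
theorem le_eigenvalueCounts_of_isotropic {d : ℕ} (hA : A.IsHermitian)
    (g : (Fin d → ℝ) →ₗ[ℝ] (V → ℝ)) (h0 : ∀ t, g t ⬝ᵥ (A *ᵥ g t) = 0)
    (h1 : ∀ t, A *ᵥ g t = 0 → t = 0) :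
    d ≤ posEigenvalueCount hA ∧ d ≤ negEigenvalueCount hA := by
  obtain ⟨c, hc⟩ := exists_eigenCoordinates hA
  have h2 : ∀ t, (∀ i, hA.eigenvalues i * c (g t) i = 0) → t = 0 := fun t ht => by
    apply h1
    apply dotProduct_eq_zero
    intro x
    rw [dotProduct_comm, hc]
    refine Finset.sum_eq_zero fun i _ => ?_
    rw [mul_left_comm, ht i, mul_zero]
  refine ⟨le_card_pos_of_isotropic c _ g (fun t => (hc _ _) ▸ h0 t) h2, ?_⟩
  have := le_card_pos_of_isotropic c (fun i => -hA.eigenvalues i) g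
    (fun t => by simpa using (hc _ _) ▸ h0 t) (fun t ht => h2 t fun i => by simpa using ht i)
  simpa [negEigenvalueCount] using this

theorem finrank_ker_add_eigenvalueCounts (hA : A.IsHermitian) :
    Module.finrank ℝ (LinearMap.ker A.mulVecLin) + (posEigenvalueCount hA + negEigenvalueCount hA)
      = Fintype.card V := by
  have h1 : posEigenvalueCount hA + negEigenvalueCount hA = A.rank := by
    rw [hA.rank_eq_card_non_zero_eigs, Fintype.card_subtype, posEigenvalueCount,
      negEigenvalueCount, ← Finset.card_union_of_disjoint]
    · congr 1
      ext i
      simp [← lt_or_lt_iff_ne, or_comm]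
    · exact Finset.disjoint_filter.2 fun i _ h h' => lt_asymm h h'
  rw [h1, Matrix.rank, add_comm, LinearMap.finrank_range_add_finrank_ker,
    Module.finrank_fintype_fun_eq_card]

theorem exists_nonpos_on_ker (hA : A.IsHermitian) :
    ∃ L : (V → ℝ) →ₗ[ℝ] ({i // 0 < hA.eigenvalues i} → ℝ), ∀ x, L x = 0 → x ⬝ᵥ (A *ᵥ x) ≤ 0 := by
  obtain ⟨c, hc⟩ := exists_eigenCoordinates hA
  refine ⟨LinearMap.funLeft ℝ ℝ Subtype.val ∘ₗ c.toLinearMap, fun x hx => ?_⟩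
  rw [hc]
  refine Finset.sum_nonpos fun i _ => ?_
  by_cases hi : 0 < hA.eigenvalues i
  · have : c x i = 0 := congrFun hx ⟨i, hi⟩
    simp [this]
  · exact mul_nonpos_of_nonpos_of_nonneg (not_lt.1 hi) (mul_self_nonneg _)

theorem exists_nonneg_on_ker (hA : A.IsHermitian) :
    ∃ L : (V → ℝ) →ₗ[ℝ] ({i // hA.eigenvalues i < 0} → ℝ), ∀ x, L x = 0 → 0 ≤ x ⬝ᵥ (A *ᵥ x) := by
  obtain ⟨c, hc⟩ := exists_eigenCoordinates hA
  refine ⟨LinearMap.funLeft ℝ ℝ Subtype.val ∘ₗ c.toLinearMap, fun x hx => ?_⟩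
  rw [hc]
  refine Finset.sum_nonneg fun i _ => ?_
  by_cases hi : hA.eigenvalues i < 0
  · have : c x i = 0 := congrFun hx ⟨i, hi⟩
    simp [this]
  · exact mul_nonneg (not_lt.1 hi) (mul_self_nonneg _)

theorem diag_perturbation_quadraticForm (t : ℝ) (i : V) (x y : V → ℝ) :
    x ⬝ᵥ ((A + Matrix.single i i t) *ᵥ y) = x ⬝ᵥ (A *ᵥ y) + t * (x i * y i) := by
  rw [add_mulVec, dotProduct_add, single_mulVec]
  simp [dotProduct, Function.update_apply]
  ring

/-- If `A` is singular, adding `t` to a diagonal entry in the support of a kernel vector lowers the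
nullity and creates at most one eigenvalue, of the sign of `t`. -/
theorem exists_diag_perturbation (hA : A.IsHermitian) {G : SimpleGraph V}
    (hG : HasGraphPattern G A)
    (hker : 0 < Module.finrank ℝ (LinearMap.ker A.mulVecLin)) {t : ℝ} (ht : t ≠ 0) :
    ∃ (B : Matrix V V ℝ) (hB : B.IsHermitian), HasGraphPattern G B ∧
      Module.finrank ℝ (LinearMap.ker B.mulVecLin) < Module.finrank ℝ (LinearMap.ker A.mulVecLin) ∧
      posEigenvalueCount hB ≤ posEigenvalueCount hA + (if 0 < t then 1 else 0) ∧
      negEigenvalueCount hB ≤ negEigenvalueCount hA + (if t < 0 then 1 else 0) := by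
  obtain ⟨⟨z, hz⟩, hz0⟩ := Module.finrank_pos_iff_exists_ne_zero.1 hker
  replace hz : A *ᵥ z = 0 := hz
  have hz0' : z ≠ 0 := fun h => hz0 (Subtype.ext h)
  obtain ⟨i, hi⟩ := Function.ne_iff.1 hz0'
  have hsymm : Aᵀ = A := by simpa [Matrix.IsHermitian] using hA
  refine ⟨A + Matrix.single i i t, ?_, ?_, ?_, ?_, ?_⟩
  · refine hA.add ?_
    simp [Matrix.IsHermitian]
  · intro a b hab
    have : Matrix.single i i t a b = 0 := by
      apply single_apply_of_ne
      rintro ⟨rfl, rfl⟩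
      exact hab rfl
    rw [Matrix.add_apply, this, add_zero]
    exact hG a b hab
  -- pairing a vector `x` in the new kernel with `z` shows that `x i = 0`
  · have hiz : ∀ x, (A + Matrix.single i i t) *ᵥ x = 0 → x i = 0 := fun x hx => by
      have h1 := diag_perturbation_quadraticForm (A := A) t i z x
      rw [hx, dotProduct_zero, dotProduct_mulVec, ← mulVec_transpose, hsymm, hz,
        zero_dotProduct, zero_add] at h1
      have h2 : z i ≠ 0 := hi
      simpa [ht, h2] using h1.symm
    apply Submodule.finrank_lt_finrank_of_lt
    refine lt_of_le_of_ne (fun x hx => ?_) fun h => ?_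
    · have h1 : (A + Matrix.single i i t) *ᵥ x = 0 := hx
      have h2 := hiz x h1
      rw [add_mulVec, single_mulVec] at h1
      simpa [h2] using h1
    · have : z ∈ LinearMap.ker (A + Matrix.single i i t).mulVecLin := by
        rw [h]; exact hz
      exact hi (hiz z this)
  · obtain ⟨L, hL⟩ := exists_nonpos_on_ker hA
    split_ifs with h
    · have := posEigenvalueCount_le_finrank (W := ({i // 0 < hA.eigenvalues i} → ℝ) × ℝ)
        (hA.add (by simp [Matrix.IsHermitian]) : (A + Matrix.single i i t).IsHermitian)
        (L.prod (LinearMap.proj i)) fun x hx => by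
          replace hx : L x = 0 ∧ x i = 0 := Prod.mk_eq_zero.1 hx
          rw [diag_perturbation_quadraticForm, hx.2]
          simpa using hL x hx.1
      simpa [posEigenvalueCount, Fintype.card_subtype] using this
    · have := posEigenvalueCount_le_finrank
        (hA.add (by simp [Matrix.IsHermitian]) : (A + Matrix.single i i t).IsHermitian)
        L fun x hx => by
          rw [diag_perturbation_quadraticForm]
          have := mul_nonpos_of_nonpos_of_nonneg (not_lt.1 h) (mul_self_nonneg (x i))
          linarith [hL x hx]
      simpa [posEigenvalueCount, Fintype.card_subtype] using this
  · obtain ⟨L, hL⟩ := exists_nonneg_on_ker hA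
    split_ifs with h
    · have := negEigenvalueCount_le_finrank (W := ({i // hA.eigenvalues i < 0} → ℝ) × ℝ)
        (hA.add (by simp [Matrix.IsHermitian]) : (A + Matrix.single i i t).IsHermitian)
        (L.prod (LinearMap.proj i)) fun x hx => by
          replace hx : L x = 0 ∧ x i = 0 := Prod.mk_eq_zero.1 hx
          rw [diag_perturbation_quadraticForm, hx.2]
          simpa using hL x hx.1
      simpa [negEigenvalueCount, Fintype.card_subtype] using this
    · have := negEigenvalueCount_le_finrank
        (hA.add (by simp [Matrix.IsHermitian]) : (A + Matrix.single i i t).IsHermitian)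
        L fun x hx => by
          rw [diag_perturbation_quadraticForm]
          have := mul_nonneg (not_lt.1 h) (mul_self_nonneg (x i))
          linarith [hL x hx]
      simpa [negEigenvalueCount, Fintype.card_subtype] using this

/-- Every point north-east of a point of the inertia table, up to the full rank, is in the table:
diagonal perturbations add one positive or one negative eigenvalue at a time. -/
theorem mem_inertiaTable_of_le {G : SimpleGraph V} {r s : ℕ} (hrs : r + s ≤ Fintype.card V)
    (hA : A.IsHermitian) (hG : HasGraphPattern G A)
    (hr : posEigenvalueCount hA ≤ r) (hs : negEigenvalueCount hA ≤ s) :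
    (r, s) ∈ inertiaTable G := by
  induction hN : Module.finrank ℝ (LinearMap.ker A.mulVecLin) using Nat.strong_induction_on
    generalizing A with
  | _ N ih =>
    have hdim := finrank_ker_add_eigenvalueCounts hA
    by_cases h : posEigenvalueCount hA = r ∧ negEigenvalueCount hA = s
    · exact ⟨A, hA, hG, by rw [h.1, h.2]⟩
    · by_cases h1 : posEigenvalueCount hA < r
      · obtain ⟨B, hB, hGB, hlt, hp, hn⟩ :=
          exists_diag_perturbation hA hG (by omega) (one_ne_zero (α := ℝ))
        norm_num at hp hn
        exact ih _ (hN ▸ hlt) hB hGB (by omega) (by omega) rfl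
      · obtain ⟨B, hB, hGB, hlt, hp, hn⟩ :=
          exists_diag_perturbation hA hG (by omega) (neg_ne_zero.2 (one_ne_zero (α := ℝ)))
        norm_num at hp hn
        exact ih _ (hN ▸ hlt) hB hGB (by omega) (by omega) rfl

end Inertia

/-! ### Indefinite orthogonal representations -/

/-- `G` has an orthogonal representation in the space of signature `(r, s)`: the Gram matrix, for
the indefinite inner product, of the vectors attached to the vertices has the pattern of `G`. -/
def HasOrthRep {V : Type*} (G : SimpleGraph V) (r s : ℕ) : Prop :=
  ∃ (p : V → Fin r → ℝ) (q : V → Fin s → ℝ),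
    ∀ i j, i ≠ j → (p i ⬝ᵥ p j - q i ⬝ᵥ q j ≠ 0 ↔ G.Adj i j)

/-- `G` has an orthogonal representation in every signature of total dimension at least `m`. -/
def IsFlexible {V : Type*} (G : SimpleGraph V) (m : ℕ) : Prop :=
  ∀ r s, m ≤ r + s → HasOrthRep G r s

theorem append_dotProduct_append {r r' : ℕ} (a b : Fin r → ℝ) (a' b' : Fin r' → ℝ) :
    Fin.append a a' ⬝ᵥ Fin.append b b' = a ⬝ᵥ b + a' ⬝ᵥ b' := by
  simp [dotProduct, Fin.sum_univ_add]

/-- The Gram matrix of the representation has at most `r` positive and `s` negative eigenvalues. -/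
theorem HasOrthRep.mem_inertiaTable {V : Type*} [Fintype V] [DecidableEq V] {G : SimpleGraph V}
    {r s : ℕ} (h : HasOrthRep G r s) (hrs : r + s ≤ Fintype.card V) :
    (r, s) ∈ inertiaTable G := by
  obtain ⟨p, q, hpq⟩ := h
  let M : Matrix V (Fin r) ℝ := Matrix.of p
  let N : Matrix V (Fin s) ℝ := Matrix.of q
  have hA : (M * Mᵀ - N * Nᵀ).IsHermitian := by
    simp [Matrix.IsHermitian, transpose_sub, transpose_mul]
  have hq : ∀ x : V → ℝ, x ⬝ᵥ ((M * Mᵀ - N * Nᵀ) *ᵥ x)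
      = (Mᵀ *ᵥ x) ⬝ᵥ (Mᵀ *ᵥ x) - (Nᵀ *ᵥ x) ⬝ᵥ (Nᵀ *ᵥ x) := fun x => by
    rw [sub_mulVec, dotProduct_sub, ← mulVec_mulVec, ← mulVec_mulVec, dotProduct_mulVec x M,
      dotProduct_mulVec x N, mulVec_transpose, mulVec_transpose]
  have hnn : ∀ {k : ℕ} (v : Fin k → ℝ), 0 ≤ v ⬝ᵥ v := fun v =>
    Finset.sum_nonneg fun i _ => mul_self_nonneg _
  refine mem_inertiaTable_of_le hrs hA (fun i j hij => hpq i j hij) ?_ ?_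
  · have := posEigenvalueCount_le_finrank hA Mᵀ.mulVecLin fun x hx => by
      replace hx : Mᵀ *ᵥ x = 0 := hx
      rw [hq, hx]
      simpa using hnn _
    simpa using this
  · have := negEigenvalueCount_le_finrank hA Nᵀ.mulVecLin fun x hx => by
      replace hx : Nᵀ *ᵥ x = 0 := hx
      rw [hq, hx]
      simpa using hnn _
    simpa using this

section OrthogonalRepresentations

variable {V : Type*} {G H : SimpleGraph V}

theorem HasOrthRep.sup {r s r' s' : ℕ} (hG : HasOrthRep G r s) (hH : HasOrthRep H r' s')
    (hd : ∀ a b, G.Adj a b → ¬ H.Adj a b) : HasOrthRep (G ⊔ H) (r + r') (s + s') := by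
  obtain ⟨p, q, h⟩ := hG
  obtain ⟨p', q', h'⟩ := hH
  refine ⟨fun i => Fin.append (p i) (p' i), fun i => Fin.append (q i) (q' i), fun i j hij => ?_⟩
  rw [append_dotProduct_append, append_dotProduct_append, SimpleGraph.sup_adj, ← h i j hij,
    ← h' i j hij, add_sub_add_comm]
  by_cases hij' : G.Adj i j
  · have h1 := hd i j hij'
    rw [← h' i j hij, not_not] at h1
    simp [h1]
  · rw [← h i j hij, not_not] at hij'
    simp [hij']

theorem isFlexible_of_edgeless (h : ∀ a b, ¬ G.Adj a b) : IsFlexible G 0 := fun r s _ =>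
  ⟨0, 0, fun i j _ => by simpa using h i j⟩

theorem IsFlexible.sup {m m' : ℕ} (hG : IsFlexible G m) (hH : IsFlexible H m')
    (hd : ∀ a b, G.Adj a b → ¬ H.Adj a b) : IsFlexible (G ⊔ H) (m + m') := fun r s hrs => by
  have h := (hG (min r m) (m - min r m) (by omega)).sup
    (hH (r - min r m) (s - (m - min r m)) (by omega)) hd
  rwa [show min r m + (r - min r m) = r by omega,
    show m - min r m + (s - (m - min r m)) = s by omega] at h

theorem IsFlexible.mono {m m' : ℕ} (hG : IsFlexible G m) (h : m ≤ m') : IsFlexible G m' :=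
  fun r s hrs => hG r s (h.trans hrs)

theorem IsFlexible.of_iSup {ι : Type*} [Fintype ι] {H : ι → SimpleGraph V} {m : ι → ℕ}
    (hG : ∀ a b, G.Adj a b ↔ ∃ i, (H i).Adj a b) (hH : ∀ i, IsFlexible (H i) (m i))
    (hd : ∀ i j, i ≠ j → ∀ a b, (H i).Adj a b → ¬ (H j).Adj a b) :
    IsFlexible G (∑ i, m i) := by
  classical
  have key : ∀ t : Finset ι, ∀ K : SimpleGraph V, (∀ a b, K.Adj a b ↔ ∃ i ∈ t, (H i).Adj a b) →
      IsFlexible K (∑ i ∈ t, m i) := by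
    intro t
    induction t using Finset.induction_on with
    | empty => exact fun K hK => isFlexible_of_edgeless fun a b => by simp [hK]
    | insert i t hi ih =>
      intro K hK
      let K' : SimpleGraph V := ⨆ j ∈ t, H j
      have hK' : ∀ a b, K'.Adj a b ↔ ∃ j ∈ t, (H j).Adj a b := by simp [K']
      have : K = H i ⊔ K' := by
        ext a b
        simp [hK, hK']
      rw [this, Finset.sum_insert hi]
      refine (hH i).sup (ih K' hK') fun a b hab hab' => ?_
      obtain ⟨j, hj, hj'⟩ := (hK' a b).1 hab'
      exact hd i j (by rintro rfl; exact hi hj) a b hab hj'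
  exact key Finset.univ G (by simpa using hG)

theorem isFlexible_of_subsingleton_edges {x y : V} (hG : ∀ a b, G.Adj a b → s(a, b) = s(x, y)) :
    IsFlexible G 1 := by
  classical
  by_cases hxy : G.Adj x y
  · have hadj : ∀ a b, a ≠ b → (G.Adj a b ↔ (a = x ∨ a = y) ∧ (b = x ∨ b = y)) := by
      intro a b hab
      constructor
      · intro h
        have := hG a b h
        rw [Sym2.eq_iff] at this
        tauto
      · rintro ⟨rfl | rfl, rfl | rfl⟩
        · exact absurd rfl hab
        · exact hxy
        · exact hxy.symm
        · exact absurd rfl hab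
    let f : V → ℝ := fun a => if a = x ∨ a = y then 1 else 0
    have hf : ∀ a b, a ≠ b → (f a * f b ≠ 0 ↔ G.Adj a b) := fun a b hab => by
      rw [hadj a b hab]
      simp only [f]
      split_ifs <;> simp_all
    intro r s hrs
    by_cases hr : 0 < r
    · refine ⟨fun a => Pi.single ⟨0, hr⟩ (f a), 0, fun a b hab => ?_⟩
      rw [← hf a b hab]
      simp
    · refine ⟨0, fun a => Pi.single ⟨0, by omega⟩ (f a), fun a b hab => ?_⟩
      rw [← hf a b hab]
      simp
  · refine (isFlexible_of_edgeless fun a b hab => hxy ?_).mono zero_le_one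
    have := hG a b hab
    rw [← SimpleGraph.mem_edgeSet] at hab ⊢
    rwa [← this]

/-- A graph is flexible in the number of its edges. The edges are listed among the pairs
`p i, p (i + 1)`, where `i` ranges over `S`; not every such pair has to be an edge. -/
theorem isFlexible_of_edges (S : Finset ℕ) (p : ℕ → V)
    (hG : ∀ a b, G.Adj a b → ∃ i ∈ S, s(a, b) = s(p i, p (i + 1))) : IsFlexible G S.card := by
  classical
  induction S using Finset.induction_on generalizing G with
  | empty => exact isFlexible_of_edgeless fun a b h => by simpa using hG a b h
  | insert i S hi ih =>
    let G₁ : SimpleGraph V := SimpleGraph.fromEdgeSet {e | e ∈ G.edgeSet ∧ e = s(p i, p (i + 1))}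
    let G₂ : SimpleGraph V := SimpleGraph.fromEdgeSet {e | e ∈ G.edgeSet ∧ e ≠ s(p i, p (i + 1))}
    have hsup : G = G₂ ⊔ G₁ := by
      ext a b
      simp only [G₁, G₂, SimpleGraph.sup_adj, SimpleGraph.fromEdgeSet_adj, Set.mem_ofPred_eq,
        SimpleGraph.mem_edgeSet]
      constructor
      · intro h
        have := h.ne
        tauto
      · tauto
    rw [hsup, Finset.card_insert_of_notMem hi]
    refine (ih fun a b hab => ?_).sup
      (isFlexible_of_subsingleton_edges (x := p i) (y := p (i + 1)) fun a b hab => ?_)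
      fun a b hab hab' => ?_
    · simp only [G₂, SimpleGraph.fromEdgeSet_adj, Set.mem_ofPred_eq, SimpleGraph.mem_edgeSet] at hab
      obtain ⟨j, hj, hj'⟩ := hG a b hab.1.1
      rcases Finset.mem_insert.1 hj with rfl | hj
      · exact absurd hj' hab.1.2
      · exact ⟨j, hj, hj'⟩
    · exact ((SimpleGraph.fromEdgeSet_adj _).1 hab).1.2
    · exact ((SimpleGraph.fromEdgeSet_adj _).1 hab).1.2 ((SimpleGraph.fromEdgeSet_adj _).1 hab').1.2

/-- Joining an isolated vertex `v` to arbitrary vertices costs one hyperbolic plane: the new edges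
are the form `x_v * ∑ x_b`, a difference of two squares. -/
theorem HasOrthRep.add_vertex {r s : ℕ} (v : V) (hH : HasOrthRep H r s)
    (hv : ∀ a, ¬ H.Adj v a) (hHG : ∀ a b, a ≠ v → b ≠ v → (H.Adj a b ↔ G.Adj a b)) :
    HasOrthRep G (r + 1) (s + 1) := by
  classical
  obtain ⟨p, q, h⟩ := hH
  let f : V → ℝ := fun a => if G.Adj v a then 1 else 0
  refine ⟨fun a => Fin.append (p a) (fun _ => if a = v then 1 else f a),
    fun a => Fin.append (q a) (fun _ => if a = v then 1 else -f a), fun a b hab => ?_⟩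
  rw [append_dotProduct_append, append_dotProduct_append, add_sub_add_comm]
  simp only [dotProduct, Finset.univ_unique, Finset.sum_singleton]
  by_cases ha : a = v
  · subst ha
    have h0 : p a ⬝ᵥ p b - q a ⬝ᵥ q b = 0 := by
      by_contra h1
      exact hv b ((h a b hab).1 h1)
    rw [dotProduct, dotProduct] at h0
    rw [h0]
    simp only [if_true, if_neg hab.symm, f]
    split_ifs with hab' <;> norm_num [hab']
  · by_cases hb : b = v
    · subst hb
      have h0 : p a ⬝ᵥ p b - q a ⬝ᵥ q b = 0 := by
        by_contra h1
        exact hv a ((h a b hab).1 h1).symm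
      rw [dotProduct, dotProduct] at h0
      rw [h0, G.adj_comm a b]
      simp only [if_true, if_neg hab, f]
      split_ifs with hab' <;> norm_num [hab']
    · rw [← hHG a b ha hb, ← h a b hab]
      simp [ha, hb, dotProduct]

end OrthogonalRepresentations

/-! ### Cycles -/

/-- To be flexible in `m` it suffices to find, for all choices of `m` signs, linear forms `f j` such
that `∑ j, ε j * (f j) ^ 2` has the pattern of `G`. -/
theorem isFlexible_of_signs {V : Type*} {G : SimpleGraph V} (m : ℕ)
    (h : ∀ ε : ℕ → ℝ, (∀ j, ε j * ε j = 1) → ∃ f : ℕ → V → ℝ,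
      ∀ a b, a ≠ b → (∑ j ∈ Finset.range m, ε j * (f j a * f j b) ≠ 0 ↔ G.Adj a b)) :
    IsFlexible G m := by
  have key : ∀ r s, r + s = m → HasOrthRep G r s := by
    rintro r s rfl
    obtain ⟨f, hf⟩ := h (fun j => if j < r then 1 else -1) fun j => by split_ifs <;> norm_num
    refine ⟨fun a j => f j a, fun a j => f (r + j) a, fun a b hab => ?_⟩
    rw [← hf a b hab, Finset.sum_range, Fin.sum_univ_add]
    simp [dotProduct, sub_eq_add_neg]
  intro r s hrs
  have h1 := (key (min r m) (m - min r m) (by omega)).sup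
    (isFlexible_of_edgeless (G := ⊥) (by simp) (r - min r m) (s - (m - min r m)) (by omega))
    (by simp)
  rwa [sup_bot_eq, show min r m + (r - min r m) = r by omega,
    show m - min r m + (s - (m - min r m)) = s by omega] at h1

/-- The fan triangulation of the cycle `0, 1, …, m + 1` from the vertex `0`, with one linear form
per triangle `0, j + 1, j + 2`. The weights at the apex alternate, up to the signs `ε`, so that
the two contributions to each diagonal of the fan cancel. -/
theorem fan_gram {m : ℕ} (hm : 1 ≤ m) {ε : ℕ → ℝ} (hε : ∀ j, ε j * ε j = 1)
    {f : ℕ → ℕ → ℝ} (hf : ∀ j i, f j i =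
      if i = 0 then (-1) ^ j * ε j else if i = j + 1 ∨ i = j + 2 then 1 else 0)
    {i i' : ℕ} (hii : i < i') :
    ∑ j ∈ Finset.range m, ε j * (f j i * f j i') ≠ 0 ↔
      i' < m + 2 ∧ (i + 1 = i' ∨ i = 0 ∧ i' = m + 1) := by
  have hε0 : ∀ j, ε j ≠ 0 := fun j h => by simpa [h] using hε j
  rcases Nat.eq_zero_or_pos i with rfl | hi
  · have h1 : ∀ j, ε j * (f j 0 * f j i') =
        (if j = i' - 1 then (-1) ^ j else 0) + (if j + 2 = i' then (-1) ^ j else 0) := by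
      intro j
      rw [hf, hf, if_pos rfl, if_neg (by omega)]
      have h2 : ε j * ((-1) ^ j * ε j * 1) = (-1 : ℝ) ^ j := by
        rw [mul_one, mul_left_comm, hε, mul_one]
      by_cases h3 : i' = j + 1
      · rw [if_pos (Or.inl h3), h2, if_pos (by omega), if_neg (by omega), add_zero]
      · by_cases h4 : i' = j + 2
        · rw [if_pos (Or.inr h4), h2, if_neg (by omega), if_pos (by omega), zero_add]
        · rw [if_neg (by omega), if_neg (by omega), if_neg (by omega)]
          simp
    simp_rw [h1]
    rw [Finset.sum_add_distrib]
    rcases (show i' = 1 ∨ 2 ≤ i' by omega) with rfl | h2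
    · rw [Finset.sum_eq_single 0 (by intro b _ hb; rw [if_neg (by omega)])
        (by intro h; exact absurd (Finset.mem_range.2 (by omega)) h),
        Finset.sum_eq_zero (by intro b _; rw [if_neg (by omega)])]
      simp
    · obtain ⟨d, rfl⟩ : ∃ d, i' = d + 2 := ⟨i' - 2, by omega⟩
      have e1 : ∑ j ∈ Finset.range m, (if j = d + 2 - 1 then (-1 : ℝ) ^ j else 0) =
          if d + 1 < m then (-1) ^ (d + 1) else 0 := by
        rw [show d + 2 - 1 = d + 1 by omega, Finset.sum_ite_eq']
        simp
      have e2 : ∑ j ∈ Finset.range m, (if j + 2 = d + 2 then (-1 : ℝ) ^ j else 0) =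
          if d < m then (-1) ^ d else 0 := by
        simp only [Nat.add_right_cancel_iff]
        rw [Finset.sum_ite_eq']
        simp
      rw [e1, e2]
      rcases lt_trichotomy (d + 1) m with h | h | h
      · rw [if_pos h, if_pos (by omega), pow_succ]
        simp
        omega
      · rw [if_neg (by omega), if_pos (by omega)]
        simp
        omega
      · rw [if_neg (by omega), if_neg (by omega)]
        simp
        omega
  · have h1 : ∀ j, ε j * (f j i * f j i') = if j = i - 1 then
        (if i + 1 = i' then ε j else 0) else 0 := by
      intro j
      rw [hf, hf, if_neg hi.ne', if_neg (show ¬ i' = 0 by omega)]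
      split_ifs <;> first | omega | simp
    simp_rw [h1]
    rw [Finset.sum_ite_eq']
    simp only [Finset.mem_range]
    split_ifs with h2 h3
    · simp only [ne_eq, hε0, not_false_eq_true, true_iff]
      omega
    · simp
      omega
    · simp
      omega

/-- A cycle on `k` vertices is flexible in `k - 2`. -/
theorem isFlexible_cycle {V : Type*} {G : SimpleGraph V} {p : ℕ → V} {k : ℕ} (hk : 3 ≤ k)
    (hinj : Set.InjOn p (Set.Iio k)) (hclosed : p k = p 0)
    (hG : ∀ a b, G.Adj a b ↔ ∃ i < k, s(a, b) = s(p i, p (i + 1))) : IsFlexible G (k - 2) := by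
  classical
  obtain ⟨m, rfl⟩ : ∃ m, k = m + 2 := ⟨k - 2, by omega⟩
  rw [Nat.add_sub_cancel]
  -- `idx` inverts `p`; its value `m + 2` off the cycle is out of reach of all the forms
  obtain ⟨idx, hidx, hout⟩ : ∃ idx : V → ℕ, (∀ i < m + 2, idx (p i) = i) ∧
      ∀ a, idx a < m + 2 → p (idx a) = a := by
    refine ⟨fun a => if h : ∃ i < m + 2, p i = a then h.choose else m + 2, fun i hi => ?_,
      fun a ha => ?_⟩
    · have h : ∃ i' < m + 2, p i' = p i := ⟨i, hi, rfl⟩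
      simp only [dif_pos h]
      exact hinj h.choose_spec.1 hi h.choose_spec.2
    · by_cases h : ∃ i < m + 2, p i = a
      · simp only [dif_pos h]
        exact h.choose_spec.2
      · simp only [dif_neg h, lt_irrefl] at ha
  refine isFlexible_of_signs m fun ε hε => ?_
  refine ⟨fun j a => if idx a = 0 then (-1) ^ j * ε j
    else if idx a = j + 1 ∨ idx a = j + 2 then 1 else 0, ?_⟩
  have key : ∀ a b, idx a < idx b → (∑ j ∈ Finset.range m, ε j *
      ((if idx a = 0 then (-1) ^ j * ε j else if idx a = j + 1 ∨ idx a = j + 2 then 1 else 0) *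
      (if idx b = 0 then (-1) ^ j * ε j else if idx b = j + 1 ∨ idx b = j + 2 then 1 else 0))
      ≠ 0 ↔ G.Adj a b) := by
    intro a b hab
    rw [fan_gram (by omega) hε (f := fun j i => if i = 0 then (-1) ^ j * ε j
      else if i = j + 1 ∨ i = j + 2 then 1 else 0) (fun _ _ => rfl) hab, hG]
    constructor
    · rintro ⟨hb, h | ⟨h, h'⟩⟩
      · exact ⟨idx a, by omega, by rw [h, hout a (by omega), hout b hb]⟩
      · refine ⟨m + 1, by omega, ?_⟩
        rw [← h', hout b hb, h', show m + 1 + 1 = m + 2 from rfl, hclosed, ← h,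
          hout a (by omega), Sym2.eq_swap]
    · rintro ⟨i, hi, h⟩
      have h2 : idx (p (i + 1)) = if i = m + 1 then 0 else i + 1 := by
        split_ifs with h3
        · rw [h3, show m + 1 + 1 = m + 2 from rfl, hclosed, hidx 0 (by omega)]
        · exact hidx _ (by omega)
      rcases Sym2.eq_iff.1 h with ⟨rfl, rfl⟩ | ⟨rfl, rfl⟩
      · rw [hidx i hi, h2] at *
        split_ifs at * <;> omega
      · rw [hidx i hi, h2] at *
        split_ifs at * <;> omega
  intro a b hab
  rcases lt_trichotomy (idx a) (idx b) with h | h | h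
  · exact key a b h
  · by_cases ha : idx a < m + 2
    · exact absurd (by rw [← hout a ha, h, hout b (h ▸ ha)]) hab
    · have h0 : ∀ j ∈ Finset.range m, ε j *
        ((if idx a = 0 then (-1) ^ j * ε j else if idx a = j + 1 ∨ idx a = j + 2 then 1 else 0) *
        (if idx b = 0 then (-1) ^ j * ε j else if idx b = j + 1 ∨ idx b = j + 2 then 1 else 0))
          = 0 := fun j hj => by
        have := Finset.mem_range.1 hj
        rw [if_neg (by omega), if_neg (by omega)]
        simp
      rw [Finset.sum_eq_zero h0]
      simp only [ne_eq, not_true_eq_false, false_iff, hG]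
      rintro ⟨i, hi, hs⟩
      rcases Sym2.eq_iff.1 hs with ⟨h1, -⟩ | ⟨-, h1⟩
      · rw [h1, hidx i hi] at ha
        exact ha hi
      · rw [h, h1, hidx i hi] at ha
        exact ha hi
  · rw [G.adj_comm, ← key b a h]
    simp only [mul_comm]

/-! ### Arms and nullity -/

section

variable {V : Type*} [Fintype V] (A : Matrix V V ℝ) (w : Bool → V)

/-- `U` is an arm of `A` with end `e`, relative to the centers `w`: outside `U` the rows of `A`
indexed by `U` are supported on the centers, and a vector that vanishes at the centers and at `e`
and satisfies the kernel equations at the vertices of `U` vanishes on `U`. -/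
structure IsArm (U : Set V) (e : V) : Prop where
  avoid : ∀ s, w s ∉ U
  apply_eq_zero : ∀ a ∈ U, ∀ b ∉ U, (∀ s, b ≠ w s) → A a b = 0
  forces : ∀ y : V → ℝ, (∀ s, y (w s) = 0) → y e = 0 → (∀ a ∈ U, (A *ᵥ y) a = 0) →
    ∀ a ∈ U, y a = 0

/-- The vertex `x` is attached to the set `U` at `e` alone. -/
structure IsAttached (x : V) (U : Set V) (e : V) : Prop where
  ne_zero : A x e ≠ 0
  eq_zero : ∀ b ∈ U, b ≠ e → A x b = 0

/-- The principal submatrix of `A` on `U` is singular. -/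
def IsSingularOn (U : Set V) : Prop :=
  ∃ x : V → ℝ, x ≠ 0 ∧ (∀ a ∉ U, x a = 0) ∧ ∀ a ∈ U, (A *ᵥ x) a = 0

variable {A w} {U : Set V} {e : V} {x y : V → ℝ}

theorem mulVec_apply_eq_sum_mul (A : Matrix V V ℝ) (x : V → ℝ) (a : V) :
    (A *ᵥ x) a = ∑ b, A a b * x b := rfl

theorem mulVec_apply_eq_of_attached {a : V} (h : IsAttached A a U e)
    (hx : ∀ b ∉ U, A a b ≠ 0 → x b = 0) : (A *ᵥ x) a = A a e * x e := by
  rw [mulVec_apply_eq_sum_mul]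
  refine Finset.sum_eq_single e (fun b _ hb => ?_) (by simp)
  by_cases hbU : b ∈ U
  · rw [h.eq_zero b hbU hb, zero_mul]
  · by_cases hab : A a b = 0
    · rw [hab, zero_mul]
    · rw [hx b hbU hab, mul_zero]

theorem mulVec_apply_eq_zero {a : V} (hx : ∀ b, A a b ≠ 0 → x b = 0) : (A *ᵥ x) a = 0 := by
  rw [mulVec_apply_eq_sum_mul]
  refine Finset.sum_eq_zero fun b _ => ?_
  by_cases hab : A a b = 0
  · simp [hab]
  · simp [hx b hab]

/-- A kernel vector that vanishes at both centers vanishes on every nonsingular arm. -/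
theorem IsArm.eq_zero_of_not_singular (hU : IsArm A w U e) (hs : ¬ IsSingularOn A U)
    (hy : A *ᵥ y = 0) (hyw : ∀ s, y (w s) = 0) : ∀ a ∈ U, y a = 0 := by
  classical
  by_contra! hne
  obtain ⟨a, ha, hya⟩ := hne
  refine hs ⟨fun b => if b ∈ U then y b else 0, fun h => hya ?_, fun b hb => if_neg hb,
    fun b hb => ?_⟩
  · simpa [ha] using congrFun h a
  · refine Eq.trans ?_ (congrFun hy b)
    rw [mulVec_apply_eq_sum_mul, mulVec_apply_eq_sum_mul]
    refine Finset.sum_congr rfl fun c _ => ?_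
    by_cases hc : c ∈ U
    · simp [hc]
    · by_cases hcw : ∃ s, c = w s
      · obtain ⟨s, rfl⟩ := hcw
        simp [hyw s]
      · rw [hU.apply_eq_zero b hb c hc fun s h => hcw ⟨s, h⟩, zero_mul, zero_mul]

/-- A null vector of the principal submatrix on an arm, extended by zero, is mapped to a vector
that is supported on the centers. -/
theorem IsArm.mulVec_eq_zero (hA : A.IsSymm) (hU : IsArm A w U e) (hx : ∀ a ∉ U, x a = 0)
    (hAx : ∀ a ∈ U, (A *ᵥ x) a = 0) {b : V} (hb : ∀ s, b ≠ w s) : (A *ᵥ x) b = 0 := by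
  by_cases hbU : b ∈ U
  · exact hAx b hbU
  · refine mulVec_apply_eq_zero fun c hc => hx c fun hcU => hc ?_
    rw [← hA.apply]
    exact hU.apply_eq_zero c hcU b hbU hb

theorem IsArm.ne_zero_of_singular (hU : IsArm A w U e) (hx0 : x ≠ 0) (hx : ∀ a ∉ U, x a = 0)
    (hAx : ∀ a ∈ U, (A *ᵥ x) a = 0) : x e ≠ 0 := by
  intro h
  apply hx0
  ext a
  by_cases ha : a ∈ U
  · exact hU.forces x (fun s => hx _ (hU.avoid s)) h hAx a ha
  · exact hx a ha

theorem IsArm.eq_zero_of_ker (hU : IsArm A w U e) (hy : A *ᵥ y = 0) (hyw : ∀ s, y (w s) = 0)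
    (he : y e = 0) : ∀ a ∈ U, y a = 0 :=
  hU.forces y hyw he fun a _ => congrFun hy a

/-- The kernel equation at `a` forces the last arm attached to `a`: if a kernel vector vanishes at
the other neighbors of `a`, it vanishes on the arm. -/
theorem IsArm.eq_zero_of_attached (hU : IsArm A w U e) {a : V} (ha : IsAttached A a U e)
    (hy : A *ᵥ y = 0) (hyw : ∀ s, y (w s) = 0) (h : ∀ b ∉ U, A a b ≠ 0 → y b = 0) :
    ∀ a ∈ U, y a = 0 := by
  refine hU.eq_zero_of_ker hy hyw ?_
  have h3 := mulVec_apply_eq_of_attached ha h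
  rw [hy] at h3
  exact (mul_eq_zero.1 h3.symm).resolve_left ha.ne_zero

theorem IsArm.mulVec_apply_ne_zero (hU : IsArm A w U e) {a : V} (ha : IsAttached A a U e)
    (hx0 : x ≠ 0) (hx : ∀ a ∉ U, x a = 0) (hAx : ∀ a ∈ U, (A *ᵥ x) a = 0) : (A *ᵥ x) a ≠ 0 := by
  rw [mulVec_apply_eq_of_attached ha fun b hb _ => hx b hb]
  exact mul_ne_zero ha.ne_zero (hU.ne_zero_of_singular hx0 hx hAx)

theorem dotProduct_mulVec_comm (hA : A.IsSymm) (x y : V → ℝ) :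
    x ⬝ᵥ (A *ᵥ y) = y ⬝ᵥ (A *ᵥ x) := by
  rw [dotProduct_mulVec, ← mulVec_transpose, hA.eq, dotProduct_comm]

/-- A vector that vanishes at the centers is orthogonal to one whose image is supported there. -/
theorem dotProduct_mulVec_eq_zero (hx : ∀ s, x (w s) = 0)
    (hy : ∀ b, (∀ s, b ≠ w s) → (A *ᵥ y) b = 0) : x ⬝ᵥ (A *ᵥ y) = 0 := by
  refine Finset.sum_eq_zero fun b _ => ?_
  by_cases hb : ∃ s, b = w s
  · obtain ⟨s, rfl⟩ := hb
    rw [hx s, zero_mul]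
  · rw [hy b fun s h => hb ⟨s, h⟩, mul_zero]

theorem Bool.forall_of_not {P : Bool → Prop} (s : Bool) (h : P s) (h' : P !s) (t : Bool) : P t := by
  cases s <;> cases t <;> assumption

/-- A kernel vector `y` is orthogonal to the image of `x`; if that image is supported on the two
centers, this is one linear relation between the values of `y` at the centers. -/
theorem ker_pairing (hA : A.IsSymm) {s : Bool} (hw : w s ≠ w !s)
    (hx : ∀ b, (∀ s, b ≠ w s) → (A *ᵥ x) b = 0) (hy : A *ᵥ y = 0) :
    y (w s) * (A *ᵥ x) (w s) + y (w !s) * (A *ᵥ x) (w !s) = 0 := by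
  classical
  have h := dotProduct_mulVec_comm hA x y
  rw [hy, dotProduct_zero, dotProduct] at h
  rw [← Finset.sum_subset (Finset.subset_univ {w s, w !s}), Finset.sum_pair hw] at h
  · exact h.symm
  · intro b _ hb
    simp only [Finset.mem_insert, Finset.mem_singleton, not_or] at hb
    rw [hx b (Bool.forall_of_not s hb.1 hb.2), mul_zero]

theorem one_le_eigenvalueCounts [DecidableEq V] (hA : A.IsHermitian)
    (h0 : x ⬝ᵥ (A *ᵥ x) = 0) (h1 : A *ᵥ x ≠ 0) :
    1 ≤ posEigenvalueCount hA ∧ 1 ≤ negEigenvalueCount hA := by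
  refine le_eigenvalueCounts_of_isotropic hA
    ((LinearMap.toSpanSingleton ℝ (V → ℝ) x) ∘ₗ LinearMap.proj (0 : Fin 1)) (fun t => ?_)
    fun t ht => ?_
  · simp [mulVec_smul, h0]
  · have h2 : t 0 • (A *ᵥ x) = 0 := by simpa [mulVec_smul] using ht
    ext i
    rw [Subsingleton.elim i 0]
    exact (smul_eq_zero.1 h2).resolve_right h1

theorem two_le_eigenvalueCounts [DecidableEq V] (hA : A.IsHermitian)
    (hxx : x ⬝ᵥ (A *ᵥ x) = 0) (hxy : x ⬝ᵥ (A *ᵥ y) = 0) (hyy : y ⬝ᵥ (A *ᵥ y) = 0)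
    (h1 : ∀ a b : ℝ, a • (A *ᵥ x) + b • (A *ᵥ y) = 0 → a = 0 ∧ b = 0) :
    2 ≤ posEigenvalueCount hA ∧ 2 ≤ negEigenvalueCount hA := by
  have hyx : y ⬝ᵥ (A *ᵥ x) = 0 := by
    rw [dotProduct_mulVec_comm (by simpa [Matrix.IsHermitian, Matrix.IsSymm] using hA), hxy]
  refine le_eigenvalueCounts_of_isotropic hA
    ((LinearMap.toSpanSingleton ℝ (V → ℝ) x) ∘ₗ LinearMap.proj (0 : Fin 2) +
      (LinearMap.toSpanSingleton ℝ (V → ℝ) y) ∘ₗ LinearMap.proj (1 : Fin 2)) (fun t => ?_)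
    fun t ht => ?_
  · simp [mulVec_smul, mulVec_add, hxx, hxy, hyy, hyx]
  · obtain ⟨h2, h3⟩ := h1 (t 0) (t 1) (by simpa [mulVec_smul, mulVec_add] using ht)
    ext i
    fin_cases i
    exacts [h2, h3]

end

/-- The vertices other than the two centers `w true` and `w false` are covered by arms: arms `cyc`
that come from the cycles at a center, pendant arms `pend s` attached only to the center `w s`, and
two arms `link` attached at either end to one of the centers. The end `linkEnd q s` is the one at
`w s`. -/
structure ArmSystem {V : Type*} [Fintype V] (A : Matrix V V ℝ) (w : Bool → V) (κ : Type*)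
    (β : Bool → ℕ) where
  cyc : κ → Set V
  cycEnd : κ → V
  pend : ∀ s, Fin (β s) → Set V
  pendEnd : ∀ s, Fin (β s) → V
  link : Bool → Set V
  linkEnd : Bool → Bool → V
  centers_ne : ∀ s, w s ≠ w !s
  isArm_cyc : ∀ i, IsArm A w (cyc i) (cycEnd i)
  isArm_pend : ∀ s i, IsArm A w (pend s i) (pendEnd s i)
  isAttached_pend : ∀ s i, IsAttached A (w s) (pend s i) (pendEnd s i)
  pend_eq_zero : ∀ s i, ∀ b ∈ pend s i, A (w !s) b = 0
  isArm_link : ∀ q s, IsArm A w (link q) (linkEnd q s)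
  isAttached_link : ∀ q s, IsAttached A (w s) (link q) (linkEnd q s)
  cover : ∀ a, (∃ s, a = w s) ∨ (∃ i, a ∈ cyc i) ∨ (∃ s i, a ∈ pend s i) ∨ ∃ q, a ∈ link q

namespace ArmSystem

variable {V κ : Type*} [Fintype V] {A : Matrix V V ℝ} {w : Bool → V}
  {β : Bool → ℕ} (D : ArmSystem A w κ β) {x y : V → ℝ}

theorem eq_zero (h1 : ∀ s, y (w s) = 0) (h2 : ∀ i, ∀ a ∈ D.cyc i, y a = 0)
    (h3 : ∀ s i, ∀ a ∈ D.pend s i, y a = 0) (h4 : ∀ q, ∀ a ∈ D.link q, y a = 0) : y = 0 := by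
  ext a
  rcases D.cover a with ⟨s, rfl⟩ | ⟨i, h⟩ | ⟨s, i, h⟩ | ⟨q, h⟩
  exacts [h1 s, h2 i a h, h3 s i a h, h4 q a h]

/-- If every arm other than the `k`-th pendant arm at `t` is zero, so is that one. -/
theorem pend_eq_zero_of_others (hy : A *ᵥ y = 0) (h1 : ∀ s, y (w s) = 0)
    (h2 : ∀ i, ∀ a ∈ D.cyc i, y a = 0) (h4 : ∀ q, ∀ a ∈ D.link q, y a = 0) {t : Bool}
    (k : Fin (β t)) (h3 : ∀ j, j ≠ k → ∀ a ∈ D.pend t j, y a = 0) :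
    ∀ a ∈ D.pend t k, y a = 0 := by
  refine (D.isArm_pend t k).eq_zero_of_attached (D.isAttached_pend t k) hy h1 fun b hb hab => ?_
  rcases D.cover b with ⟨s, rfl⟩ | ⟨i, h⟩ | ⟨s, i, h⟩ | ⟨q, h⟩
  · exact h1 s
  · exact h2 i b h
  · by_cases hs : s = t
    · subst hs
      exact h3 i (by rintro rfl; exact hb h) b h
    · have ht : t = !s := Bool.eq_not.2 (Ne.symm hs)
      exact absurd (ht ▸ D.pend_eq_zero s i b h) hab
  · exact h4 q b h

/-- If every arm that meets the center `t`, other than the link `q`, is zero, so is `q`. -/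
theorem link_eq_zero_of_others (hy : A *ᵥ y = 0) (h1 : ∀ s, y (w s) = 0)
    (h2 : ∀ i, ∀ a ∈ D.cyc i, y a = 0) {t q : Bool} (h3 : ∀ j, ∀ a ∈ D.pend t j, y a = 0)
    (h4 : ∀ a ∈ D.link (!q), y a = 0) : ∀ a ∈ D.link q, y a = 0 := by
  refine (D.isArm_link q t).eq_zero_of_attached (D.isAttached_link q t) hy h1 fun b hb hab => ?_
  rcases D.cover b with ⟨s, rfl⟩ | ⟨i, h⟩ | ⟨s, i, h⟩ | ⟨q', h⟩
  · exact h1 s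
  · exact h2 i b h
  · by_cases hs : s = t
    · subst hs
      exact h3 i b h
    · have ht : t = !s := Bool.eq_not.2 (Ne.symm hs)
      exact absurd (ht ▸ D.pend_eq_zero s i b h) hab
  · have hq' : q' = !q := Bool.eq_not.2 (by rintro rfl; exact hb h)
    exact h4 b (hq' ▸ h)

variable [DecidableEq V]

/-- The ends of the pendant arms at `t`, with the arm `k` left out. -/
def pendEndsErase (t : Bool) (k : Fin (β t)) : Finset V := (Finset.univ.erase k).image (D.pendEnd t)

theorem card_pendEndsErase_lt (t : Bool) (k : Fin (β t)) : (D.pendEndsErase t k).card < β t := by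
  refine lt_of_le_of_lt Finset.card_image_le ?_
  rw [Finset.card_erase_of_mem (Finset.mem_univ k), Finset.card_univ, Fintype.card_fin]
  exact Nat.sub_lt k.pos one_pos

theorem pend_eq_zero_of_ne (hy : A *ᵥ y = 0) (h1 : ∀ s, y (w s) = 0) {t : Bool} {k : Fin (β t)}
    (h2 : ∀ a ∈ D.pendEndsErase t k, y a = 0) (j : Fin (β t)) (hj : j ≠ k) :
    ∀ a ∈ D.pend t j, y a = 0 :=
  (D.isArm_pend t j).eq_zero_of_ker hy h1 (h2 _ (Finset.mem_image_of_mem _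
    (Finset.mem_erase.2 ⟨hj, Finset.mem_univ j⟩)))

variable [Fintype κ]

/-- The ends of the arms coming from cycles. -/
def cycEnds : Finset V := Finset.univ.image D.cycEnd

theorem card_cycEnds_le : D.cycEnds.card ≤ Fintype.card κ := Finset.card_image_le

theorem cyc_eq_zero (hy : A *ᵥ y = 0) (h1 : ∀ s, y (w s) = 0) (h2 : ∀ a ∈ D.cycEnds, y a = 0)
    (i : κ) : ∀ a ∈ D.cyc i, y a = 0 :=
  (D.isArm_cyc i).eq_zero_of_ker hy h1 (h2 _ (Finset.mem_image_of_mem _ (Finset.mem_univ i)))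

/-- If all pendant arms are nonsingular, the values at the ends of the cyclic arms and two further
values determine a kernel vector: those at the centers if the links are nonsingular, and otherwise
those at one center and at the end of a singular link. -/
theorem finrank_ker_le_of_nonsingular (hA : A.IsSymm)
    (hsing : ∀ s i, ¬ IsSingularOn A (D.pend s i)) :
    Module.finrank ℝ (LinearMap.ker A.mulVecLin) ≤ Fintype.card κ + 2 := by
  have hpz : ∀ y : V → ℝ, A *ᵥ y = 0 → (∀ s, y (w s) = 0) → ∀ s i, ∀ a ∈ D.pend s i, y a = 0 :=
    fun y hy h1 s i => (D.isArm_pend s i).eq_zero_of_not_singular (hsing s i) hy h1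
  by_cases hQ : ∃ q, IsSingularOn A (D.link q)
  · obtain ⟨q, x, hx0, hx, hAx⟩ := hQ
    refine (finrank_ker_le_card_of_determining (D.cycEnds ∪ {w true, D.linkEnd q true})
      fun y hy hyT => ?_).trans ?_
    · have h1 : ∀ t, y (w t) = 0 := by
        have h2 : y (w true) = 0 := hyT _ (by simp)
        refine Bool.forall_of_not true h2 ?_
        have h3 := ker_pairing hA (D.centers_ne true)
          (fun b hb => (D.isArm_link q true).mulVec_eq_zero hA hx hAx hb) hy
        rw [h2, zero_mul, zero_add] at h3
        exact (mul_eq_zero.1 h3).resolve_right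
          ((D.isArm_link q _).mulVec_apply_ne_zero (D.isAttached_link q _) hx0 hx hAx)
      have h3 := D.cyc_eq_zero hy h1 fun a ha => hyT a (by simp [ha])
      have h4 := hpz y hy h1
      have h5 := (D.isArm_link q true).eq_zero_of_ker hy h1 (hyT _ (by simp))
      have h6 : ∀ a ∈ D.link (!q), y a = 0 :=
        D.link_eq_zero_of_others (t := true) hy h1 h3 (h4 true) (by rwa [Bool.not_not])
      exact D.eq_zero h1 h3 h4 (Bool.forall_of_not q h5 h6)
    · refine (Finset.card_union_le _ _).trans ?_
      have := Finset.card_le_two (a := w true) (b := D.linkEnd q true)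
      have := D.card_cycEnds_le
      omega
  · push Not at hQ
    refine (finrank_ker_le_card_of_determining (D.cycEnds ∪ {w true, w false})
      fun y hy hyT => ?_).trans ?_
    · have h1 : ∀ t, y (w t) = 0 :=
        Bool.forall_of_not true (hyT _ (by simp)) (hyT _ (by simp))
      exact D.eq_zero h1 (D.cyc_eq_zero hy h1 fun a ha => hyT a (by simp [ha])) (hpz y hy h1)
        fun q => (D.isArm_link q true).eq_zero_of_not_singular (hQ q) hy h1
    · refine (Finset.card_union_le _ _).trans ?_
      have := Finset.card_le_two (a := w true) (b := w false)
      have := D.card_cycEnds_le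
      omega

/-- A singular pendant arm at `w s` yields an isotropic vector and makes kernel vectors vanish at
`w s`. If another arm is singular and attached to the other center, the isotropic subspace becomes a
plane and kernel vectors vanish at both centers. -/
theorem nullity_of_singular_pend (hA : A.IsHermitian) {s : Bool} {i : Fin (β s)}
    (hsing : IsSingularOn A (D.pend s i)) :
    1 ≤ posEigenvalueCount hA ∧ 1 ≤ negEigenvalueCount hA ∧
      Module.finrank ℝ (LinearMap.ker A.mulVecLin) ≤ Fintype.card κ + β s ∨
    2 ≤ posEigenvalueCount hA ∧ 2 ≤ negEigenvalueCount hA ∧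
      Module.finrank ℝ (LinearMap.ker A.mulVecLin) ≤ Fintype.card κ + β s + β !s := by
  have hsymm : A.IsSymm := by simpa [Matrix.IsHermitian, Matrix.IsSymm] using hA
  obtain ⟨x, hx0, hx, hAx⟩ := hsing
  have hAx' : ∀ b, (∀ s, b ≠ w s) → (A *ᵥ x) b = 0 := fun b hb =>
    (D.isArm_pend s i).mulVec_eq_zero hsymm hx hAx hb
  have hxw : ∀ t, x (w t) = 0 := fun t => hx _ ((D.isArm_pend s i).avoid t)
  have hxs : (A *ᵥ x) (w s) ≠ 0 :=
    (D.isArm_pend s i).mulVec_apply_ne_zero (D.isAttached_pend s i) hx0 hx hAx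
  have hxs' : (A *ᵥ x) (w !s) = 0 := mulVec_apply_eq_zero fun b hb => hx b fun hbU =>
    hb (D.pend_eq_zero s i b hbU)
  have hxx : x ⬝ᵥ (A *ᵥ x) = 0 := dotProduct_mulVec_eq_zero hxw hAx'
  have hys : ∀ y, A *ᵥ y = 0 → y (w s) = 0 := fun y hy => by
    simpa [hxs', hxs] using ker_pairing hsymm (D.centers_ne s) hAx' hy
  -- a second vector whose image does not vanish at the other center
  have htwo : ∀ z : V → ℝ, (∀ t, z (w t) = 0) → (∀ b, (∀ s, b ≠ w s) → (A *ᵥ z) b = 0) →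
      (A *ᵥ z) (w !s) ≠ 0 → (2 ≤ posEigenvalueCount hA ∧ 2 ≤ negEigenvalueCount hA) ∧
      ∀ y, A *ᵥ y = 0 → ∀ t, y (w t) = 0 := by
    intro z hz hAz hzs
    refine ⟨two_le_eigenvalueCounts hA hxx (dotProduct_mulVec_eq_zero hxw hAz)
      (dotProduct_mulVec_eq_zero hz hAz) fun a b hab => ?_,
      fun y hy => Bool.forall_of_not s (hys y hy) ?_⟩
    · have h1 := congrFun hab (w !s)
      simp only [Pi.add_apply, Pi.smul_apply, hxs', smul_zero, zero_add, Pi.zero_apply] at h1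
      have hb := (smul_eq_zero.1 h1).resolve_right hzs
      have h2 := congrFun hab (w s)
      simp only [Pi.add_apply, Pi.smul_apply, hb, zero_smul, add_zero, Pi.zero_apply] at h2
      exact ⟨(smul_eq_zero.1 h2).resolve_right hxs, hb⟩
    · have h := ker_pairing hsymm (D.centers_ne s) hAz hy
      rw [hys y hy, zero_mul, zero_add] at h
      exact (mul_eq_zero.1 h).resolve_right hzs
  by_cases hsing' : ∃ j, IsSingularOn A (D.pend (!s) j)
  · obtain ⟨j, z, hz0, hz, hAz⟩ := hsing'
    obtain ⟨h2, hyw⟩ := htwo z (fun t => hz _ ((D.isArm_pend _ j).avoid t))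
      (fun b hb => (D.isArm_pend _ j).mulVec_eq_zero hsymm hz hAz hb)
      ((D.isArm_pend _ j).mulVec_apply_ne_zero (D.isAttached_pend _ j) hz0 hz hAz)
    refine Or.inr ⟨h2.1, h2.2, ?_⟩
    refine (finrank_ker_le_card_of_determining (D.cycEnds ∪ (D.pendEndsErase s i ∪
      (D.pendEndsErase (!s) j ∪ {D.linkEnd true true, D.linkEnd false true})))
      fun y hy hyT => ?_).trans ?_
    · have h1 := hyw y hy
      have h3 := D.cyc_eq_zero hy h1 fun a ha => hyT a (by simp [ha])
      have h4 : ∀ q, ∀ a ∈ D.link q, y a = 0 := fun q =>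
        (D.isArm_link q true).eq_zero_of_ker hy h1 (hyT _ (by cases q <;> simp))
      have h5 := D.pend_eq_zero_of_ne hy h1 (k := i) fun a ha => hyT a (by simp [ha])
      have h6 := D.pend_eq_zero_of_ne hy h1 (k := j) fun a ha => hyT a (by simp [ha])
      refine D.eq_zero h1 h3 (Bool.forall_of_not s (fun k => ?_) fun k => ?_) h4
      · by_cases hk : k = i
        · exact hk ▸ D.pend_eq_zero_of_others hy h1 h3 h4 i h5
        · exact h5 k hk
      · by_cases hk : k = j
        · exact hk ▸ D.pend_eq_zero_of_others hy h1 h3 h4 j h6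
        · exact h6 k hk
    · have e1 := Finset.card_union_le D.cycEnds (D.pendEndsErase s i ∪
        (D.pendEndsErase (!s) j ∪ {D.linkEnd true true, D.linkEnd false true}))
      have e2 := Finset.card_union_le (D.pendEndsErase s i)
        (D.pendEndsErase (!s) j ∪ {D.linkEnd true true, D.linkEnd false true})
      have e3 := Finset.card_union_le (D.pendEndsErase (!s) j)
        {D.linkEnd true true, D.linkEnd false true}
      have e4 := Finset.card_le_two (a := D.linkEnd true true) (b := D.linkEnd false true)
      have e5 := D.card_cycEnds_le
      have e6 := D.card_pendEndsErase_lt s i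
      have e7 := D.card_pendEndsErase_lt (!s) j
      omega
  push Not at hsing'
  have hpz : ∀ y : V → ℝ, A *ᵥ y = 0 → (∀ s, y (w s) = 0) → ∀ j, ∀ a ∈ D.pend (!s) j, y a = 0 :=
    fun y hy h1 j => (D.isArm_pend _ j).eq_zero_of_not_singular (hsing' j) hy h1
  by_cases hQ : ∃ q, IsSingularOn A (D.link q)
  · obtain ⟨q, z, hz0, hz, hAz⟩ := hQ
    obtain ⟨h2, hyw⟩ := htwo z (fun t => hz _ ((D.isArm_link q true).avoid t))
      (fun b hb => (D.isArm_link q true).mulVec_eq_zero hsymm hz hAz hb)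
      ((D.isArm_link q _).mulVec_apply_ne_zero (D.isAttached_link q _) hz0 hz hAz)
    refine Or.inr ⟨h2.1, h2.2, ?_⟩
    refine (finrank_ker_le_card_of_determining (D.cycEnds ∪ (D.pendEndsErase s i ∪
      {D.linkEnd q true})) fun y hy hyT => ?_).trans ?_
    · have h1 := hyw y hy
      have h3 := D.cyc_eq_zero hy h1 fun a ha => hyT a (by simp [ha])
      have h5 := D.pend_eq_zero_of_ne hy h1 (k := i) fun a ha => hyT a (by simp [ha])
      have h6 := hpz y hy h1
      have h7 := (D.isArm_link q true).eq_zero_of_ker hy h1 (hyT _ (by simp))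
      have h8 : ∀ a ∈ D.link (!q), y a = 0 :=
        D.link_eq_zero_of_others (t := !s) hy h1 h3 h6 (by rwa [Bool.not_not])
      have h4 := Bool.forall_of_not (P := fun q => ∀ a ∈ D.link q, y a = 0) q h7 h8
      refine D.eq_zero h1 h3 (Bool.forall_of_not s (fun k => ?_) h6) h4
      by_cases hk : k = i
      · exact hk ▸ D.pend_eq_zero_of_others hy h1 h3 h4 i h5
      · exact h5 k hk
    · have e1 := Finset.card_union_le D.cycEnds (D.pendEndsErase s i ∪ {D.linkEnd q true})
      have e2 := Finset.card_union_le (D.pendEndsErase s i) {D.linkEnd q true}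
      have e4 := Finset.card_singleton (D.linkEnd q true)
      have e5 := D.card_cycEnds_le
      have e6 := D.card_pendEndsErase_lt s i
      omega
  · push Not at hQ
    obtain ⟨h2, h3⟩ := one_le_eigenvalueCounts hA hxx fun h => hxs (congrFun h _)
    refine Or.inl ⟨h2, h3, ?_⟩
    refine (finrank_ker_le_card_of_determining (D.cycEnds ∪ (D.pendEndsErase s i ∪ {w !s}))
      fun y hy hyT => ?_).trans ?_
    · have h1 : ∀ t, y (w t) = 0 := Bool.forall_of_not s (hys y hy) (hyT _ (by simp))
      have h3 := D.cyc_eq_zero hy h1 fun a ha => hyT a (by simp [ha])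
      have h5 := D.pend_eq_zero_of_ne hy h1 (k := i) fun a ha => hyT a (by simp [ha])
      have h4 : ∀ q, ∀ a ∈ D.link q, y a = 0 := fun q =>
        (D.isArm_link q true).eq_zero_of_not_singular (hQ q) hy h1
      refine D.eq_zero h1 h3 (Bool.forall_of_not s (fun k => ?_) (hpz y hy h1)) h4
      by_cases hk : k = i
      · exact hk ▸ D.pend_eq_zero_of_others hy h1 h3 h4 i h5
      · exact h5 k hk
    · have e1 := Finset.card_union_le D.cycEnds (D.pendEndsErase s i ∪ {w !s})
      have e2 := Finset.card_union_le (D.pendEndsErase s i) {w !s}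
      have e4 := Finset.card_singleton (w !s)
      have e5 := D.card_cycEnds_le
      have e6 := D.card_pendEndsErase_lt s i
      omega

end ArmSystem

/-! ### Tracing paths and cycles -/

/-- `P` is the path `p 0, …, p l`, and it starts at `x`. -/
structure IsPathTrace {V : Type*} {G : SimpleGraph V} (P : G.Subgraph) (x : V) (p : ℕ → V)
    (l : ℕ) : Prop where
  one_le : 1 ≤ l
  mem_verts : ∀ a, a ∈ P.verts ↔ ∃ i ≤ l, p i = a
  adj : ∀ a b, P.Adj a b ↔ ∃ i < l, s(a, b) = s(p i, p (i + 1))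
  injOn : Set.InjOn p (Set.Iic l)
  start : p 0 = x

/-- `P` is the cycle `p 0, …, p l = p 0` of length `l`, traversed from `x`. -/
structure IsCycleTrace {V : Type*} {G : SimpleGraph V} (P : G.Subgraph) (x : V) (p : ℕ → V)
    (l : ℕ) : Prop where
  three_le : 3 ≤ l
  mem_verts : ∀ a, a ∈ P.verts ↔ ∃ i < l, p i = a
  adj : ∀ a b, P.Adj a b ↔ ∃ i < l, s(a, b) = s(p i, p (i + 1))
  injOn : Set.InjOn p (Set.Iio l)
  closed : p l = p 0
  start : p 0 = x

section Trace

variable {V : Type*} {G : SimpleGraph V} {P : G.Subgraph} {x : V} {p : ℕ → V} {l : ℕ}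

theorem IsPathFrom.exists_trace (h : IsPathFrom x P) : ∃ p l, IsPathTrace P x p l := by
  obtain ⟨k, e, hx, he⟩ := h
  let q : ℕ → Fin (k + 2) := fun i => ⟨min i (k + 1), by omega⟩
  have hq : ∀ j : Fin (k + 2), q j = j := fun j => Fin.ext (by simp only [q]; omega)
  refine ⟨fun i => e.symm (q i), k + 1, by omega, fun a => ?_, fun a b => ?_, ?_, ?_⟩
  · constructor
    · intro ha
      exact ⟨e ⟨a, ha⟩, by omega, by simp [hq]⟩
    · rintro ⟨i, -, rfl⟩
      exact (e.symm (q i)).2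
  · constructor
    · intro hab
      have h1 : (SimpleGraph.pathGraph (k + 2)).Adj (e ⟨a, P.edge_vert hab⟩)
          (e ⟨b, P.edge_vert hab.symm⟩) := e.map_adj_iff.2 hab
      rw [SimpleGraph.pathGraph_adj] at h1
      have h2 : ∀ (c d : P.verts), (e c).val + 1 = (e d).val →
          ∃ i < k + 1, s((c : V), (d : V)) = s(((e.symm (q i) : P.verts) : V),
            ((e.symm (q (i + 1)) : P.verts) : V)) := fun c d hcd =>
        ⟨e c, by omega, by rw [hq, hcd, hq]; simp⟩
      rcases h1 with h1 | h1
      · exact h2 _ _ h1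
      · obtain ⟨i, hi, h⟩ := h2 _ _ h1
        exact ⟨i, hi, by rw [← h, Sym2.eq_swap]⟩
    · rintro ⟨i, hi, h⟩
      have h1 : P.coe.Adj (e.symm (q i)) (e.symm (q (i + 1))) := by
        rw [e.symm.map_adj_iff, SimpleGraph.pathGraph_adj]
        left
        simp only [q]
        omega
      have h2 : P.Adj (e.symm (q i)) (e.symm (q (i + 1))) := h1
      rcases Sym2.eq_iff.1 h with ⟨rfl, rfl⟩ | ⟨rfl, rfl⟩
      exacts [h2, h2.symm]
  · intro i hi j hj hij
    have h1 := congrArg Fin.val (e.symm.injective (Subtype.ext hij))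
    simp only [q, Set.mem_Iic] at h1 hi hj
    omega
  · have h1 : q 0 = e ⟨x, hx⟩ := by rw [he]; rfl
    simp only [h1, RelIso.symm_apply_apply]

open Fin.CommRing in
theorem IsCycleSubgraph.exists_trace (h : IsCycleSubgraph P) (hx : x ∈ P.verts) :
    ∃ p l, IsCycleTrace P x p l := by
  obtain ⟨k, hk, ⟨e⟩⟩ := h
  obtain ⟨n, rfl⟩ : ∃ n, k = n + 2 := ⟨k - 2, by omega⟩
  let q : ℕ → Fin (n + 2) := fun i => e ⟨x, hx⟩ + (i : Fin (n + 2))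
  have hq1 : ∀ i, q (i + 1) = q i + 1 := fun i => by simp [q, add_assoc]
  have hsurj : ∀ j : Fin (n + 2), ∃ i < n + 2, q i = j := fun j =>
    ⟨(j - e ⟨x, hx⟩ : Fin (n + 2)).val, Fin.is_lt _, by simp [q]⟩
  refine ⟨fun i => e.symm (q i), n + 2, hk, fun a => ?_, fun a b => ?_, ?_, ?_, ?_⟩
  · constructor
    · intro ha
      obtain ⟨i, hi, h⟩ := hsurj (e ⟨a, ha⟩)
      exact ⟨i, hi, by simp [h]⟩
    · rintro ⟨i, -, rfl⟩
      exact (e.symm (q i)).2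
  · constructor
    · intro hab
      have h1 : (SimpleGraph.cycleGraph (n + 2)).Adj (e ⟨a, P.edge_vert hab⟩)
          (e ⟨b, P.edge_vert hab.symm⟩) := e.map_adj_iff.2 hab
      rw [SimpleGraph.cycleGraph_adj] at h1
      have h2 : ∀ (c d : P.verts), e d - e c = 1 →
          ∃ i < n + 2, s((c : V), (d : V)) = s(((e.symm (q i) : P.verts) : V),
            ((e.symm (q (i + 1)) : P.verts) : V)) := fun c d hcd => by
        obtain ⟨i, hi, h⟩ := hsurj (e c)
        refine ⟨i, hi, ?_⟩
        rw [hq1, h, show e c + 1 = e d by rw [← hcd, add_sub_cancel]]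
        simp
      rcases h1 with h1 | h1
      · obtain ⟨i, hi, h⟩ := h2 _ _ h1
        exact ⟨i, hi, by rw [← h, Sym2.eq_swap]⟩
      · exact h2 _ _ h1
    · rintro ⟨i, hi, h⟩
      have h1 : P.coe.Adj (e.symm (q i)) (e.symm (q (i + 1))) := by
        rw [e.symm.map_adj_iff, SimpleGraph.cycleGraph_adj, hq1]
        right
        simp
      have h2 : P.Adj (e.symm (q i)) (e.symm (q (i + 1))) := h1
      rcases Sym2.eq_iff.1 h with ⟨rfl, rfl⟩ | ⟨rfl, rfl⟩
      exacts [h2, h2.symm]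
  · intro i hi j hj hij
    have h1 : (i : Fin (n + 2)) = (j : Fin (n + 2)) :=
      add_left_cancel (e.symm.injective (Subtype.ext hij))
    have h2 := congrArg Fin.val h1
    rwa [Fin.val_natCast, Fin.val_natCast, Nat.mod_eq_of_lt hi, Nat.mod_eq_of_lt hj] at h2
  · simp [q]
  · simp [q]

theorem IsPathTrace.adj_iff (h : IsPathTrace P x p l) {i : ℕ} (h1 : 1 ≤ i) (hl : i ≤ l) (b : V) :
    P.Adj (p i) b ↔ b = p (i - 1) ∨ i < l ∧ b = p (i + 1) := by
  rw [h.adj]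
  constructor
  · rintro ⟨j, hj, hs⟩
    rcases Sym2.eq_iff.1 hs with ⟨h2, rfl⟩ | ⟨h2, rfl⟩
    · have := h.injOn hl hj.le h2
      subst this
      exact Or.inr ⟨hj, rfl⟩
    · have := h.injOn hl (Nat.succ_le_of_lt hj) h2
      subst this
      exact Or.inl rfl
  · rintro (rfl | ⟨hi, rfl⟩)
    · exact ⟨i - 1, by omega, by rw [Nat.sub_add_cancel h1, Sym2.eq_swap]⟩
    · exact ⟨i, hi, rfl⟩

theorem IsCycleTrace.adj_iff (h : IsCycleTrace P x p l) {i : ℕ} (h1 : 1 ≤ i) (hl : i < l) (b : V) :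
    P.Adj (p i) b ↔ b = p (i - 1) ∨ b = p (i + 1) := by
  rw [h.adj]
  constructor
  · rintro ⟨j, hj, hs⟩
    rcases Sym2.eq_iff.1 hs with ⟨h2, rfl⟩ | ⟨h2, rfl⟩
    · have := h.injOn hl hj h2
      subst this
      exact Or.inr rfl
    · by_cases hj' : j + 1 = l
      · rw [hj', h.closed] at h2
        have := h.injOn hl (show 0 < l by omega) h2
        omega
      · have := h.injOn hl (show j + 1 < l by omega) h2
        subst this
        exact Or.inl rfl
  · rintro (rfl | rfl)
    · exact ⟨i - 1, by omega, by rw [Nat.sub_add_cancel h1, Sym2.eq_swap]⟩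
    · exact ⟨i, hl, rfl⟩

theorem IsPathTrace.ncard_verts (h : IsPathTrace P x p l) : P.verts.ncard = l + 1 := by
  have h1 : P.verts = p '' Set.Iic l := by
    ext a
    exact h.mem_verts a
  rw [h1, h.injOn.ncard_image]
  simp

theorem IsCycleTrace.ncard_verts (h : IsCycleTrace P x p l) : P.verts.ncard = l := by
  have h1 : P.verts = p '' Set.Iio l := by
    ext a
    exact h.mem_verts a
  rw [h1, h.injOn.ncard_image]
  simp

end Trace

/-! ### Arms of a graph -/

section Arms

variable {V : Type*} {G : SimpleGraph V} {A : Matrix V V ℝ} {w : Bool → V} {p : ℕ → V} {m : ℕ}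

/-- Along a walk from a center each kernel equation determines the next value from the previous
ones. -/
theorem isArm_of_walk [Fintype V] (hG : HasGraphPattern G A) (h0 : ∃ s, p 0 = w s)
    (havoid : ∀ i, 1 ≤ i → i ≤ m → ∀ s, p i ≠ w s)
    (hadj : ∀ i, 1 ≤ i → i < m → G.Adj (p i) (p (i + 1)))
    (hnbr : ∀ i, 1 ≤ i → i ≤ m → ∀ b, G.Adj (p i) b →
      b = p (i - 1) ∨ (i < m ∧ b = p (i + 1)) ∨ ∃ s, b = w s) :
    IsArm A w (p '' Set.Icc 1 m) (p 1) := by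
  refine ⟨?_, ?_, ?_⟩
  · rintro s ⟨i, hi, h⟩
    exact havoid i hi.1 hi.2 s h
  · rintro _ ⟨i, hi, rfl⟩ b hb hbw
    have hib : p i ≠ b := fun h => hb ⟨i, hi, h⟩
    by_contra hne
    rcases hnbr i hi.1 hi.2 b ((hG _ _ hib).1 hne) with rfl | ⟨h, rfl⟩ | ⟨s, rfl⟩
    · by_cases h1 : i = 1
      · obtain ⟨s, hs⟩ := h0
        exact hbw s (by rw [h1, ← hs])
      · have := hi.1
        have := hi.2
        exact hb ⟨i - 1, ⟨by omega, by omega⟩, rfl⟩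
    · exact hb ⟨i + 1, ⟨by omega, h⟩, rfl⟩
    · exact hbw s rfl
  · intro y hyw hy1 hy
    have hy0 : y (p 0) = 0 := by
      obtain ⟨s, hs⟩ := h0
      rw [hs, hyw]
    have key : ∀ i, i ≤ m → y (p i) = 0 := by
      intro i
      induction i using Nat.strong_induction_on with
      | _ i ih =>
        intro him
        rcases i with _ | _ | i
        · exact hy0
        · exact hy1
        · have h1 := hy (p (i + 1)) ⟨i + 1, ⟨by omega, by omega⟩, rfl⟩
          rw [mulVec_apply_eq_sum_mul, Finset.sum_eq_single (p (i + 2))] at h1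
          · have h2 := hadj (i + 1) (by omega) (by omega)
            exact (mul_eq_zero.1 h1).resolve_left ((hG _ _ h2.ne).2 h2)
          · intro b _ hb
            by_cases hib : p (i + 1) = b
            · rw [← hib, ih (i + 1) (by omega) (by omega), mul_zero]
            · by_cases hne : A (p (i + 1)) b = 0
              · rw [hne, zero_mul]
              · rcases hnbr (i + 1) (by omega) (by omega) b ((hG _ _ hib).1 hne) with
                  rfl | ⟨-, rfl⟩ | ⟨s, rfl⟩
                · rw [Nat.add_sub_cancel, ih i (by omega) (by omega), mul_zero]
                · exact absurd rfl hb
                · rw [hyw, mul_zero]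
          · exact fun h => absurd (Finset.mem_univ _) h
    rintro _ ⟨i, hi, rfl⟩
    exact key i hi.2

theorem isAttached_of_walk (hG : HasGraphPattern G A) {x : V} (hadj : G.Adj x (p 1))
    (havoid : ∀ i, 1 ≤ i → i ≤ m → p i ≠ x) (h : ∀ i, 2 ≤ i → i ≤ m → ¬ G.Adj (p i) x) :
    IsAttached A x (p '' Set.Icc 1 m) (p 1) := by
  refine ⟨(hG _ _ hadj.ne).2 hadj, ?_⟩
  rintro _ ⟨i, hi, rfl⟩ hne
  by_contra h1
  have h2 := (hG _ _ (havoid i hi.1 hi.2).symm).1 h1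
  have hi1 : i ≠ 1 := by
    rintro rfl
    exact hne rfl
  have := hi.1
  exact h i (by omega) hi.2 h2.symm

/-- `p 1, …, p m` is a path in `G` without centers whose only neighbors outside the path are the
center `p 0 = w s` of `p 1` and the center `p (m + 1) = w t` of `p m`. -/
structure IsSegment (G : SimpleGraph V) (w : Bool → V) (s t : Bool) (p : ℕ → V) (m : ℕ) :
    Prop where
  one_le : 1 ≤ m
  start : p 0 = w s
  finish : p (m + 1) = w t
  avoid : ∀ i, 1 ≤ i → i ≤ m → ∀ s, p i ≠ w s
  adj_iff : ∀ i, 1 ≤ i → i ≤ m → ∀ b, G.Adj (p i) b ↔ b = p (i - 1) ∨ b = p (i + 1)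

theorem IsSegment.isArm [Fintype V] {s t : Bool} (h : IsSegment G w s t p m)
    (hG : HasGraphPattern G A) : IsArm A w (p '' Set.Icc 1 m) (p 1) := by
  refine isArm_of_walk hG ⟨s, h.start⟩ h.avoid
    (fun i h1 h2 => (h.adj_iff i h1 h2.le _).2 (Or.inr rfl)) fun i h1 h2 b hb => ?_
  rcases (h.adj_iff i h1 h2 b).1 hb with rfl | rfl
  · exact Or.inl rfl
  · rcases h2.lt_or_eq with h3 | rfl
    · exact Or.inr (Or.inl ⟨h3, rfl⟩)
    · exact Or.inr (Or.inr ⟨t, h.finish⟩)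

theorem IsSegment.isAttached {s t : Bool} (h : IsSegment G w s t p m) (hst : w s ≠ w t)
    (hG : HasGraphPattern G A) : IsAttached A (w s) (p '' Set.Icc 1 m) (p 1) := by
  refine isAttached_of_walk hG ?_ (fun i h1 h2 => h.avoid i h1 h2 s) fun i h1 h2 hadj => ?_
  · exact ((h.adj_iff 1 le_rfl h.one_le _).2 (Or.inl h.start.symm)).symm
  · rcases (h.adj_iff i (by omega) h2 _).1 hadj with h3 | h3
    · exact h.avoid (i - 1) (by omega) (by omega) s h3.symm
    · rcases h2.lt_or_eq with h4 | rfl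
      · exact h.avoid (i + 1) (by omega) h4 s h3.symm
      · exact hst (h3.trans h.finish)

theorem IsSegment.reverse {s t : Bool} (h : IsSegment G w s t p m) :
    IsSegment G w t s (fun j => p (m + 1 - j)) m := by
  refine ⟨h.one_le, h.finish, ?_, fun i h1 h2 => h.avoid _ (by omega) (by omega),
    fun i h1 h2 b => ?_⟩
  · simpa using h.start
  · rw [h.adj_iff _ (by omega) (by omega), or_comm, show m + 1 - i + 1 = m + 1 - (i - 1) by omega,
      Nat.sub_sub]

theorem image_reverse (p : ℕ → V) (m : ℕ) :
    (fun j => p (m + 1 - j)) '' Set.Icc 1 m = p '' Set.Icc 1 m := by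
  ext a
  constructor
  · rintro ⟨i, ⟨h1, h2⟩, rfl⟩
    exact ⟨m + 1 - i, ⟨by omega, by omega⟩, rfl⟩
  · rintro ⟨i, ⟨h1, h2⟩, rfl⟩
    exact ⟨m + 1 - i, ⟨by omega, by omega⟩, by simp only [show m + 1 - (m + 1 - i) = i by omega]⟩

theorem IsSegment.isArm_end [Fintype V] {s t : Bool} (h : IsSegment G w s t p m)
    (hG : HasGraphPattern G A) : IsArm A w (p '' Set.Icc 1 m) (p m) := by
  have h1 := h.reverse.isArm hG
  rwa [image_reverse] at h1

theorem IsSegment.isAttached_end {s t : Bool} (h : IsSegment G w s t p m) (hst : w s ≠ w t)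
    (hG : HasGraphPattern G A) : IsAttached A (w t) (p '' Set.Icc 1 m) (p m) := by
  have h1 := h.reverse.isAttached hst.symm hG
  rwa [image_reverse] at h1

end Arms

/-! ### The pieces of a pulsar -/

/-- The cycles and the pendant paths of a supernova as one family. -/
theorem IsSupernova.exists_family {V : Type*} {G : SimpleGraph V} {v : V} {α β : ℕ}
    {S : G.Subgraph} (h : IsSupernova v α β S) :
    ∃ P : Fin α ⊕ Fin β → G.Subgraph,
      (∀ i, IsCycleSubgraph (P (.inl i)) ∧ v ∈ (P (.inl i)).verts) ∧
      (∀ j, IsPathFrom v (P (.inr j))) ∧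
      (∀ i j, i ≠ j → ∀ a ∈ (P i).verts, a ∈ (P j).verts → a = v) ∧
      (∀ a, a ∈ S.verts ↔ a = v ∨ ∃ i, a ∈ (P i).verts) ∧
      ∀ a b, S.Adj a b ↔ ∃ i, (P i).Adj a b := by
  obtain ⟨A, B, ⟨P, hP, hPP, rfl⟩, ⟨C, hC, hCC, rfl⟩, hAB, rfl⟩ := h
  have hPC : ∀ i j, ∀ a ∈ (C i).verts, a ∈ (P j).verts → a = v := by
    intro i j a hi hj
    have : a ∈ (G.singletonSubgraph v ⊔ ⨆ i, P i).verts ∩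
        (G.singletonSubgraph v ⊔ ⨆ i, C i).verts := by
      simp only [SimpleGraph.Subgraph.verts_sup, SimpleGraph.Subgraph.verts_iSup]
      exact ⟨Or.inr (Set.mem_iUnion.2 ⟨j, hj⟩), Or.inr (Set.mem_iUnion.2 ⟨i, hi⟩)⟩
    rw [hAB] at this
    exact this
  refine ⟨Sum.elim C P, hC, hP, ?_, fun a => ?_, fun a b => ?_⟩
  · rintro (i | i) (j | j) hij a hi hj
    · have := hCC i j (by rintro rfl; exact hij rfl)
      exact this.subset ⟨hi, hj⟩
    · exact hPC i j a hi hj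
    · exact hPC j i a hj hi
    · have := hPP i j (by rintro rfl; exact hij rfl)
      exact this.subset ⟨hi, hj⟩
  · simp
    tauto
  · simp
    tauto

/-- The graph `G` is the union of the pieces of a pulsar with centers `w true` and `w false`: the
index `none` stands for the cycle through both centers, `some ⟨s, .inl i⟩` and `some ⟨s, .inr i⟩`
for the cycles and the pendant paths at `w s`. Two pieces meet only in a center to which both
belong. -/
structure IsPulsarFamily {V : Type*} (G : SimpleGraph V) (w : Bool → V) (α β : Bool → ℕ)
    (P : Option (Σ s, Fin (α s) ⊕ Fin (β s)) → G.Subgraph) : Prop where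
  centers_ne : w true ≠ w false
  cyc : ∀ s i, IsCycleSubgraph (P (some ⟨s, .inl i⟩)) ∧ w s ∈ (P (some ⟨s, .inl i⟩)).verts
  pend : ∀ s i, IsPathFrom (w s) (P (some ⟨s, .inr i⟩))
  mid : IsCycleSubgraph (P none)
  mem_mid : ∀ s, w s ∈ (P none).verts
  not_adj : ¬ (P none).Adj (w true) (w false)
  inter : ∀ i j, i ≠ j → ∀ a ∈ (P i).verts, a ∈ (P j).verts →
    ∃ s, a = w s ∧ (∀ x, i = some x → x.1 = s) ∧ ∀ x, j = some x → x.1 = s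
  adj_iff : ∀ a b, G.Adj a b ↔ ∃ i, (P i).Adj a b
  cover : ∀ a, ∃ i, a ∈ (P i).verts

theorem IsPulsar.exists_family {V : Type*} {G : SimpleGraph V} {α₁ β₁ α₂ β₂ : ℕ}
    (h : IsPulsar G α₁ β₁ α₂ β₂) :
    ∃ (w : Bool → V) (P : Option (Σ s, Fin (cond s α₁ α₂) ⊕ Fin (cond s β₁ β₂)) → G.Subgraph),
      IsPulsarFamily G w (fun s => cond s α₁ α₂) (fun s => cond s β₁ β₂) P := by
  obtain ⟨v, u, S₁, C, S₂, K, h1, h2, hC, hv, hu, hvu, hnadj, ⟨hK, rfl⟩, ⟨hT, htop⟩⟩ := h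
  obtain ⟨P₁, hc1, hp1, hi1, hv1, ha1⟩ := h1.exists_family
  obtain ⟨P₂, hc2, hp2, hi2, hv2, ha2⟩ := h2.exists_family
  have h1C : ∀ i, ∀ a ∈ (P₁ i).verts, a ∈ C.verts → a = v := fun i a h h' =>
    hK.subset ⟨(hv1 a).2 (Or.inr ⟨i, h⟩), h'⟩
  have h2C : ∀ i, ∀ a ∈ (P₂ i).verts, a ∈ C.verts → a = u := fun i a h h' =>
    hT.subset ⟨Or.inr h', (hv2 a).2 (Or.inr ⟨i, h⟩)⟩
  have h12 : ∀ i j, ∀ a ∈ (P₁ i).verts, a ∉ (P₂ j).verts := fun i j a h h' => by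
    have hau : a = u := hT.subset ⟨Or.inl ((hv1 a).2 (Or.inr ⟨i, h⟩)), (hv2 a).2 (Or.inr ⟨j, h'⟩)⟩
    subst hau
    exact hvu (h1C i a h hu).symm
  have hadj : ∀ a b, G.Adj a b ↔ S₁.Adj a b ∨ C.Adj a b ∨ S₂.Adj a b := fun a b => by
    rw [← SimpleGraph.Subgraph.top_adj, htop, SimpleGraph.Subgraph.sup_adj,
      SimpleGraph.Subgraph.sup_adj, or_assoc]
  have hcov : ∀ a, a ∈ S₁.verts ∨ a ∈ C.verts ∨ a ∈ S₂.verts := fun a => by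
    have : a ∈ (⊤ : G.Subgraph).verts := trivial
    rw [htop] at this
    exact or_assoc.1 this
  refine ⟨fun s => cond s v u, fun
    | none => C
    | some ⟨true, x⟩ => P₁ x
    | some ⟨false, x⟩ => P₂ x, ?_⟩
  refine ⟨hvu, ?_, ?_, hC, ?_, hnadj, ?_, fun a b => ?_, fun a => ?_⟩
  · rintro (_ | _) i
    exacts [hc2 i, hc1 i]
  · rintro (_ | _) i
    exacts [hp2 i, hp1 i]
  · rintro (_ | _)
    exacts [hu, hv]
  · rintro (_ | ⟨_ | _, i⟩) (_ | ⟨_ | _, j⟩) hij a hi hj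
    · exact absurd rfl hij
    · exact ⟨false, h2C j a hj hi, by simp, by simp⟩
    · exact ⟨true, h1C j a hj hi, by simp, by simp⟩
    · exact ⟨false, h2C i a hi hj, by simp, by simp⟩
    · exact ⟨false, hi2 i j (by rintro rfl; exact hij rfl) a hi hj, by simp, by simp⟩
    · exact absurd hi (h12 j i a hj)
    · exact ⟨true, h1C i a hi hj, by simp, by simp⟩
    · exact absurd hj (h12 i j a hi)
    · exact ⟨true, hi1 i j (by rintro rfl; exact hij rfl) a hi hj, by simp, by simp⟩
  · rw [hadj, ha1, ha2]
    constructor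
    · rintro (⟨i, h⟩ | h | ⟨i, h⟩)
      exacts [⟨some ⟨true, i⟩, h⟩, ⟨none, h⟩, ⟨some ⟨false, i⟩, h⟩]
    · rintro ⟨_ | ⟨_ | _, i⟩, h⟩
      exacts [Or.inr (Or.inl h), Or.inr (Or.inr ⟨i, h⟩), Or.inl ⟨i, h⟩]
  · rcases hcov a with h | h | h
    · rcases (hv1 a).1 h with rfl | ⟨i, h⟩
      exacts [⟨none, hv⟩, ⟨some ⟨true, i⟩, h⟩]
    · exact ⟨none, h⟩
    · rcases (hv2 a).1 h with rfl | ⟨i, h⟩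
      exacts [⟨none, hu⟩, ⟨some ⟨false, i⟩, h⟩]

namespace IsPulsarFamily

variable {V : Type*} {G : SimpleGraph V} {w : Bool → V} {α β : Bool → ℕ}
  {P : Option (Σ s, Fin (α s) ⊕ Fin (β s)) → G.Subgraph}

section

variable (F : IsPulsarFamily G w α β P)
include F

theorem w_injective : Function.Injective w := by
  rintro (_ | _) (_ | _) h
  · rfl
  · exact absurd h.symm F.centers_ne
  · exact absurd h F.centers_ne
  · rfl

theorem ne_not (s : Bool) : w s ≠ w !s := fun h => by
  have := F.w_injective h
  cases s <;> simp at this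

theorem not_adj_centers (s : Bool) : ¬ (P none).Adj (w s) (w !s) := by
  cases s
  · exact fun h => F.not_adj h.symm
  · exact F.not_adj

theorem eq_of_center_mem {s : Bool} {x : Σ s, Fin (α s) ⊕ Fin (β s)}
    (h : w s ∈ (P (some x)).verts) : x.1 = s := by
  obtain ⟨t, ht, h1, -⟩ := F.inter (some x) none (by simp) _ h (F.mem_mid s)
  rw [F.w_injective ht]
  exact h1 x rfl

theorem eq_of_mem {i j : Option (Σ s, Fin (α s) ⊕ Fin (β s))} {a : V} (ha : ∀ s, a ≠ w s)
    (hi : a ∈ (P i).verts) (hj : a ∈ (P j).verts) : i = j := by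
  by_contra hij
  obtain ⟨s, hs, -⟩ := F.inter i j hij a hi hj
  exact ha s hs

theorem adj_iff_of_mem {i : Option (Σ s, Fin (α s) ⊕ Fin (β s))} {a : V} (ha : ∀ s, a ≠ w s)
    (hi : a ∈ (P i).verts) (b : V) : G.Adj a b ↔ (P i).Adj a b := by
  rw [F.adj_iff]
  constructor
  · rintro ⟨j, hj⟩
    rwa [F.eq_of_mem ha hi ((P j).edge_vert hj)]
  · exact fun h => ⟨i, h⟩

theorem not_adj_of_adj {i j : Option (Σ s, Fin (α s) ⊕ Fin (β s))} (hij : i ≠ j) {a b : V}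
    (hi : (P i).Adj a b) : ¬ (P j).Adj a b := fun hj => by
  obtain ⟨s, rfl, h1, h2⟩ := F.inter i j hij a ((P i).edge_vert hi) ((P j).edge_vert hj)
  obtain ⟨t, rfl, h3, h4⟩ := F.inter i j hij b ((P i).edge_vert hi.symm) ((P j).edge_vert hj.symm)
  have hst : s ≠ t := by
    rintro rfl
    exact hi.ne rfl
  rcases i with _ | x
  · rcases j with _ | y
    · exact hij rfl
    · exact hst ((h2 y rfl).symm.trans (h4 y rfl))
  · exact hst ((h1 x rfl).symm.trans (h3 x rfl))

theorem cyc_segment {s : Bool} {i : Fin (α s)} {p : ℕ → V} {l : ℕ}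
    (h : IsCycleTrace (P (some ⟨s, .inl i⟩)) (w s) p l) : IsSegment G w s s p (l - 1) := by
  have h3 := h.three_le
  have havoid : ∀ j, 1 ≤ j → j ≤ l - 1 → ∀ t, p j ≠ w t := fun j h1 h2 t ht => by
    have hst : s = t := F.eq_of_center_mem (x := ⟨s, .inl i⟩)
      ((h.mem_verts _).2 ⟨j, by omega, ht⟩)
    rw [← hst, ← h.start] at ht
    have := h.injOn (show j < l by omega) (show 0 < l by omega) ht
    omega
  refine ⟨by omega, h.start, ?_, havoid, fun j h1 h2 b => ?_⟩
  · rw [Nat.sub_add_cancel (by omega), h.closed, h.start]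
  · rw [F.adj_iff_of_mem (havoid j h1 h2) ((h.mem_verts _).2 ⟨j, by omega, rfl⟩),
      h.adj_iff h1 (by omega)]

theorem pend_avoid {s : Bool} {i : Fin (β s)} {p : ℕ → V} {l : ℕ}
    (h : IsPathTrace (P (some ⟨s, .inr i⟩)) (w s) p l) (j : ℕ) (h1 : 1 ≤ j) (h2 : j ≤ l)
    (t : Bool) : p j ≠ w t := fun ht => by
  have hst : s = t := F.eq_of_center_mem (x := ⟨s, .inr i⟩) ((h.mem_verts _).2 ⟨j, h2, ht⟩)
  rw [← hst, ← h.start] at ht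
  have := h.injOn h2 (Nat.zero_le l) ht
  omega

theorem pend_adj_iff {s : Bool} {i : Fin (β s)} {p : ℕ → V} {l : ℕ}
    (h : IsPathTrace (P (some ⟨s, .inr i⟩)) (w s) p l) (j : ℕ) (h1 : 1 ≤ j) (h2 : j ≤ l) (b : V) :
    G.Adj (p j) b ↔ b = p (j - 1) ∨ j < l ∧ b = p (j + 1) := by
  rw [F.adj_iff_of_mem (F.pend_avoid h j h1 h2) ((h.mem_verts _).2 ⟨j, h2, rfl⟩), h.adj_iff h1 h2]

theorem exists_center_index {s : Bool} {p : ℕ → V} {l : ℕ} (h : IsCycleTrace (P none) (w s) p l) :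
    ∃ t, 2 ≤ t ∧ t + 2 ≤ l ∧ p t = w !s := by
  obtain ⟨t, ht, hpt⟩ := (h.mem_verts _).1 (F.mem_mid !s)
  refine ⟨t, ?_, ?_, hpt⟩
  · by_contra hlt
    rcases (show t = 0 ∨ t = 1 by omega) with rfl | rfl
    · exact F.ne_not s (h.start.symm.trans hpt)
    · exact F.not_adj_centers s ((h.adj _ _).2 ⟨0, by omega, by rw [h.start, ← hpt]⟩)
  · by_contra hlt
    have h1 : t + 1 = l := by omega
    exact F.not_adj_centers s ((h.adj _ _).2 ⟨t, ht, by
      rw [h1, h.closed, h.start, ← hpt, Sym2.eq_swap]⟩)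

theorem mid_segments {s : Bool} {p : ℕ → V} {l t : ℕ} (h : IsCycleTrace (P none) (w s) p l)
    (h2 : 2 ≤ t) (htl : t + 2 ≤ l) (hpt : p t = w !s) :
    IsSegment G w s (!s) p (t - 1) ∧ IsSegment G w (!s) s (fun j => p (t + j)) (l - t - 1) := by
  have havoid : ∀ j, 1 ≤ j → j < l → j ≠ t → ∀ r, p j ≠ w r := fun j h1 h2 hjt =>
    Bool.forall_of_not s (fun hj => by
      have := h.injOn h2 (show 0 < l by omega) (hj.trans h.start.symm)
      omega) fun hj => hjt (h.injOn h2 (show t < l by omega) (hj.trans hpt.symm))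
  have hadj : ∀ j, 1 ≤ j → j < l → j ≠ t → ∀ b, G.Adj (p j) b ↔ b = p (j - 1) ∨ b = p (j + 1) :=
    fun j h1 h2 hjt b => by
      rw [F.adj_iff_of_mem (havoid j h1 h2 hjt) ((h.mem_verts _).2 ⟨j, h2, rfl⟩), h.adj_iff h1 h2]
  refine ⟨⟨by omega, h.start, by rwa [Nat.sub_add_cancel (by omega)],
    fun j h1 h2 => havoid j h1 (by omega) (by omega),
    fun j h1 h2 => hadj j h1 (by omega) (by omega)⟩,
    ⟨by omega, hpt, ?_, fun j h1 h2 => havoid _ (by omega) (by omega) (by omega),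
    fun j h1 h2 b => ?_⟩⟩
  · rw [show t + (l - t - 1 + 1) = l by omega, h.closed, h.start]
  · rw [hadj _ (by omega) (by omega) (by omega), Nat.add_sub_assoc h1, add_assoc]

/-- The arms of a matrix with the pattern of a pulsar are the paths that remain of the pieces when
the centers are deleted. -/
theorem nonempty_armSystem [Fintype V] {A : Matrix V V ℝ} (hG : HasGraphPattern G A) :
    Nonempty (ArmSystem A w (Σ s, Fin (α s)) β) := by
  choose pc lc hc using fun s i => (F.cyc s i).1.exists_trace (F.cyc s i).2
  choose pp lp hp using fun s i => (F.pend s i).exists_trace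
  obtain ⟨p, l, h⟩ := F.mid.exists_trace (F.mem_mid true)
  obtain ⟨t, h2, htl, hpt⟩ := F.exists_center_index h
  obtain ⟨hs1, hs2⟩ := F.mid_segments h h2 htl hpt
  let q : ℕ → V := fun j => p (t + j)
  refine ⟨{
    cyc := fun i => pc i.1 i.2 '' Set.Icc 1 (lc i.1 i.2 - 1)
    cycEnd := fun i => pc i.1 i.2 1
    pend := fun s i => pp s i '' Set.Icc 1 (lp s i)
    pendEnd := fun s i => pp s i 1
    link := fun r => cond r (p '' Set.Icc 1 (t - 1)) (q '' Set.Icc 1 (l - t - 1))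
    linkEnd := fun r s => cond r (cond s (p 1) (p (t - 1)))
      (cond s (q (l - t - 1)) (q 1))
    centers_ne := F.ne_not
    isArm_cyc := fun i => (F.cyc_segment (hc i.1 i.2)).isArm hG
    isArm_pend := fun s i => ?_
    isAttached_pend := fun s i => ?_
    pend_eq_zero := fun s i => ?_
    isArm_link := ?_
    isAttached_link := ?_
    cover := fun a => ?_ }⟩
  · refine isArm_of_walk hG ⟨s, (hp s i).start⟩ (F.pend_avoid (hp s i))
      (fun j h1 h2 => (F.pend_adj_iff (hp s i) j h1 h2.le _).2 (Or.inr ⟨h2, rfl⟩))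
      fun j h1 h2 b hb => ?_
    rcases (F.pend_adj_iff (hp s i) j h1 h2 b).1 hb with h | h
    exacts [Or.inl h, Or.inr (Or.inl h)]
  · refine isAttached_of_walk hG ?_ (fun j h1 h2 => F.pend_avoid (hp s i) j h1 h2 s)
      fun j h1 h2 hj => ?_
    · exact ((F.pend_adj_iff (hp s i) 1 le_rfl (hp s i).one_le _).2
        (Or.inl (hp s i).start.symm)).symm
    · rcases (F.pend_adj_iff (hp s i) j (by omega) h2 _).1 hj with h | ⟨h, h'⟩
      · exact F.pend_avoid (hp s i) (j - 1) (by omega) (by omega) s h.symm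
      · exact F.pend_avoid (hp s i) (j + 1) (by omega) h s h'.symm
  · rintro _ ⟨j, ⟨h1, h2⟩, rfl⟩
    by_contra hne
    have hj := ((hG _ _ (F.pend_avoid (hp s i) j h1 h2 _).symm).1 hne).symm
    rcases (F.pend_adj_iff (hp s i) j h1 h2 _).1 hj with h | ⟨h, h'⟩
    · rcases h1.eq_or_lt with rfl | h1
      · exact F.ne_not s ((hp s i).start.symm.trans h.symm)
      · exact F.pend_avoid (hp s i) (j - 1) (by omega) (by omega) _ h.symm
    · exact F.pend_avoid (hp s i) (j + 1) (by omega) h _ h'.symm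
  · rintro (_ | _) (_ | _)
    · exact hs2.isArm hG
    · exact hs2.isArm_end hG
    · exact hs1.isArm_end hG
    · exact hs1.isArm hG
  · rintro (_ | _) (_ | _)
    · exact hs2.isAttached F.centers_ne.symm hG
    · exact hs2.isAttached_end F.centers_ne.symm hG
    · exact hs1.isAttached_end F.centers_ne hG
    · exact hs1.isAttached F.centers_ne hG
  · by_cases ha : ∃ s, a = w s
    · exact Or.inl ha
    · push Not at ha
      right
      obtain ⟨_ | ⟨s, i | i⟩, hi⟩ := F.cover a
      · right; right
        obtain ⟨j, hj, rfl⟩ := (h.mem_verts a).1 hi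
        have hj0 : j ≠ 0 := by
          rintro rfl
          exact ha true h.start
        rcases lt_trichotomy j t with hjt | rfl | hjt
        · exact ⟨true, j, ⟨by omega, by omega⟩, rfl⟩
        · exact absurd hpt (ha _)
        · exact ⟨false, j - t, ⟨by omega, by omega⟩, by
            simp only [q, show t + (j - t) = j by omega]⟩
      · left
        obtain ⟨j, hj, rfl⟩ := ((hc s i).mem_verts a).1 hi
        have hj0 : j ≠ 0 := by
          rintro rfl
          exact ha s (hc s i).start
        exact ⟨⟨s, i⟩, j, ⟨by omega, Nat.le_sub_one_of_lt hj⟩, rfl⟩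
      · right; left
        obtain ⟨j, hj, rfl⟩ := ((hp s i).mem_verts a).1 hi
        have hj0 : j ≠ 0 := by
          rintro rfl
          exact ha s (hp s i).start
        exact ⟨s, i, j, ⟨by omega, hj⟩, rfl⟩

end

/-! ### Representations of a pulsar -/

/-- The graph obtained from `G` by deleting all edges at the centers `w s` with `s ∈ X`. -/
def isolate (G : SimpleGraph V) (w : Bool → V) (X : Finset Bool) : SimpleGraph V where
  Adj a b := G.Adj a b ∧ ∀ s ∈ X, a ≠ w s ∧ b ≠ w s
  symm := ⟨fun _ _ h => ⟨h.1.symm, fun s hs => (h.2 s hs).symm⟩⟩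
  loopless := ⟨fun _ h => h.1.ne rfl⟩

/-- Deleting the edges at the centers in `X` makes the pieces cheap, and each deleted center costs a
hyperbolic plane. -/
theorem hasOrthRep_of_isolate (X : Finset Bool) {r s : ℕ} (h : HasOrthRep (isolate G w X) r s) :
    HasOrthRep G (r + X.card) (s + X.card) := by
  induction X using Finset.induction_on generalizing r s with
  | empty =>
    have : isolate G w ∅ = G := by
      ext a b
      simp [isolate]
    rwa [this] at h
  | insert t X ht ih =>
    have h1 : HasOrthRep (isolate G w X) (r + 1) (s + 1) := by
      refine h.add_vertex (w t) (fun a ha => ?_) fun a b ha hb => ?_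
      · exact (ha.2 t (Finset.mem_insert_self t X)).1 rfl
      · simp [isolate, ha, hb]
    have h2 := ih h1
    rwa [Finset.card_insert_of_notMem ht, add_comm X.card 1, ← add_assoc, ← add_assoc]

/-- A cycle on `k` vertices needs `k - 2` forms, whether or not centers on it are isolated: either
it remains a cycle, or isolating a vertex leaves at most `k - 2` edges. -/
theorem isFlexible_piece_cycle (X : Finset Bool) {i : Option (Σ s, Fin (α s) ⊕ Fin (β s))}
    (hi : IsCycleSubgraph (P i)) {s : Bool} (hs : w s ∈ (P i).verts) :
    IsFlexible (isolate (P i).spanningCoe w X) ((P i).verts.ncard - 2) := by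
  by_cases hX : ∃ t ∈ X, w t ∈ (P i).verts
  · obtain ⟨t, ht, hti⟩ := hX
    obtain ⟨p, l, h⟩ := hi.exists_trace hti
    rw [h.ncard_verts]
    have h3 := h.three_le
    have h1 := isFlexible_of_edges (G := isolate (P i).spanningCoe w X)
      (Finset.Icc 1 (l - 2)) p fun a b hab => by
      obtain ⟨j, hj, hs⟩ := (h.adj a b).1 hab.1
      refine ⟨j, Finset.mem_Icc.2 ?_, hs⟩
      have hne : p j ≠ w t ∧ p (j + 1) ≠ w t := by
        rcases Sym2.eq_iff.1 hs with ⟨rfl, rfl⟩ | ⟨rfl, rfl⟩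
        exacts [hab.2 t ht, (hab.2 t ht).symm]
      have hj0 : j ≠ 0 := by
        rintro rfl
        exact hne.1 h.start
      have hjl : j + 1 ≠ l := fun hjl => hne.2 (by rw [hjl, h.closed, h.start])
      omega
    simpa using h1
  · push Not at hX
    obtain ⟨p, l, h⟩ := hi.exists_trace hs
    rw [h.ncard_verts]
    refine isFlexible_cycle h.three_le h.injOn h.closed fun a b => ?_
    rw [← h.adj]
    refine ⟨fun hab => hab.1, fun hab => ⟨hab, fun t ht => ⟨?_, ?_⟩⟩⟩
    · rintro rfl
      exact hX t ht ((P i).edge_vert hab)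
    · rintro rfl
      exact hX t ht ((P i).edge_vert hab.symm)

theorem isFlexible_piece_path (X : Finset Bool) {i : Option (Σ s, Fin (α s) ⊕ Fin (β s))} {s : Bool}
    (hi : IsPathFrom (w s) (P i)) :
    IsFlexible (isolate (P i).spanningCoe w X)
      ((P i).verts.ncard - 1 - if s ∈ X then 1 else 0) := by
  obtain ⟨p, l, h⟩ := hi.exists_trace
  rw [h.ncard_verts, Nat.add_sub_cancel]
  split_ifs with hs
  · have h1 := isFlexible_of_edges (G := isolate (P i).spanningCoe w X)
      (Finset.Ico 1 l) p fun a b hab => by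
      obtain ⟨j, hj, he⟩ := (h.adj a b).1 hab.1
      refine ⟨j, Finset.mem_Ico.2 ⟨?_, hj⟩, he⟩
      by_contra hj0
      have hj0 : j = 0 := by omega
      subst hj0
      rw [h.start] at he
      rcases Sym2.eq_iff.1 he with ⟨rfl, rfl⟩ | ⟨rfl, rfl⟩
      exacts [(hab.2 s hs).1 rfl, (hab.2 s hs).2 rfl]
    simpa using h1
  · have h1 := isFlexible_of_edges (G := isolate (P i).spanningCoe w X)
      (Finset.range l) p fun a b hab => by
      obtain ⟨j, hj, he⟩ := (h.adj a b).1 hab.1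
      exact ⟨j, Finset.mem_range.2 hj, he⟩
    simpa using h1

theorem isFlexible_piece_mid (F : IsPulsarFamily G w α β P) :
    IsFlexible (isolate (P none).spanningCoe w Finset.univ) ((P none).verts.ncard - 4) := by
  obtain ⟨p, l, h⟩ := F.mid.exists_trace (F.mem_mid true)
  obtain ⟨t, h2, htl, hpt⟩ := F.exists_center_index h
  rw [h.ncard_verts]
  have h1 := isFlexible_of_edges (G := isolate (P none).spanningCoe w Finset.univ)
    (Finset.Icc 1 (t - 2) ∪ Finset.Icc (t + 1) (l - 2)) p fun a b hab => by
      obtain ⟨j, hj, hs⟩ := (h.adj a b).1 hab.1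
      have hne : ∀ r, p j ≠ w r ∧ p (j + 1) ≠ w r := fun r => by
        rcases Sym2.eq_iff.1 hs with ⟨rfl, rfl⟩ | ⟨rfl, rfl⟩
        exacts [hab.2 r (Finset.mem_univ r), (hab.2 r (Finset.mem_univ r)).symm]
      have hj0 : j ≠ 0 := by
        rintro rfl
        exact (hne _).1 h.start
      have hjl : j + 1 ≠ l := fun hjl => (hne true).2 (by rw [hjl, h.closed, h.start])
      have hjt : j ≠ t := by
        rintro rfl
        exact (hne _).1 hpt
      have hjt' : j + 1 ≠ t := by
        rintro rfl
        exact (hne _).2 hpt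
      refine ⟨j, ?_, hs⟩
      rw [Finset.mem_union, Finset.mem_Icc, Finset.mem_Icc]
      omega
  refine h1.mono ((Finset.card_union_le _ _).trans ?_)
  rw [Nat.card_Icc, Nat.card_Icc]
  omega

theorem sum_inner_le [Fintype V] (F : IsPulsarFamily G w α β P) :
    ∑ i, ((P i).verts \ Set.range w).ncard + 2 ≤ Fintype.card V := by
  classical
  have hw : (Set.range w).ncard = 2 := by
    rw [← Set.image_univ, Set.ncard_image_of_injective _ F.w_injective, Set.ncard_univ]
    simp
  have hdisj : ∀ i ∈ (Finset.univ : Finset (Option (Σ s, Fin (α s) ⊕ Fin (β s)))),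
      ∀ j ∈ Finset.univ, i ≠ j → Disjoint ((P i).verts \ Set.range w).toFinset
        ((P j).verts \ Set.range w).toFinset := by
    intro i _ j _ hij
    rw [Set.disjoint_toFinset, Set.disjoint_left]
    rintro a ⟨hi, ha⟩ ⟨hj, -⟩
    exact hij (F.eq_of_mem (fun s hs => ha ⟨s, hs.symm⟩) hi hj)
  simp only [Set.ncard_eq_toFinset_card'] at hw ⊢
  rw [← hw, ← Finset.card_biUnion hdisj, ← Finset.card_union_of_disjoint]
  · exact Finset.card_le_univ _
  · rw [Finset.disjoint_biUnion_left]
    intro i _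
    rw [Set.disjoint_toFinset]
    exact Set.disjoint_sdiff_left

/-- The amount by which the number of forms spent on a piece falls short of the number of its
vertices other than the centers, when the edges at the centers in `X` are deleted. -/
def loss (X : Finset Bool) : Option (Σ s, Fin (α s) ⊕ Fin (β s)) → ℕ
  | none => if X = Finset.univ then 2 else 0
  | some ⟨_, .inl _⟩ => 1
  | some ⟨s, .inr _⟩ => if s ∈ X then 1 else 0

theorem exists_isFlexible_piece [Fintype V] (F : IsPulsarFamily G w α β P) (X : Finset Bool)
    (i : Option (Σ s, Fin (α s) ⊕ Fin (β s))) :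
    ∃ m, IsFlexible (isolate (P i).spanningCoe w X) m ∧
      m + loss X i ≤ ((P i).verts \ Set.range w).ncard := by
  have hinner : ∀ x : Σ s, Fin (α s) ⊕ Fin (β s), w x.1 ∈ (P (some x)).verts →
      ((P (some x)).verts \ Set.range w).ncard = (P (some x)).verts.ncard - 1 := by
    intro x hx
    rw [← Set.ncard_sdiff_singleton_of_mem hx]
    congr 1
    ext a
    simp only [Set.mem_sdiff, Set.mem_range, not_exists, Set.mem_singleton_iff]
    refine and_congr_right fun ha => ⟨fun h h' => h x.1 h'.symm, fun h s hs => h ?_⟩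
    rw [← hs] at ha
    rw [F.eq_of_center_mem ha, hs]
  rcases i with _ | ⟨s, i | i⟩
  · obtain ⟨p, l, h⟩ := F.mid.exists_trace (F.mem_mid true)
    obtain ⟨t, h2, htl, hpt⟩ := F.exists_center_index h
    have hl := h.ncard_verts
    have hinn : (P none).verts.ncard - 2 ≤ ((P none).verts \ Set.range w).ncard := by
      have hw : (Set.range w).ncard = 2 := by
        rw [← Set.image_univ, Set.ncard_image_of_injective _ F.w_injective, Set.ncard_univ]
        simp
      have := Set.ncard_le_ncard_sdiff_add_ncard (P none).verts (Set.range w)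
      omega
    by_cases hX : X = Finset.univ
    · subst hX
      exact ⟨_, F.isFlexible_piece_mid, by simp only [loss, if_true]; omega⟩
    · exact ⟨_, isFlexible_piece_cycle X F.mid (F.mem_mid true), by
        simp only [loss, if_neg hX]; omega⟩
  · obtain ⟨p, l, h⟩ := (F.cyc s i).1.exists_trace (F.cyc s i).2
    have hl := h.ncard_verts
    have h3 := h.three_le
    refine ⟨_, isFlexible_piece_cycle X (F.cyc s i).1 (F.cyc s i).2, ?_⟩
    rw [hinner ⟨s, .inl i⟩ (F.cyc s i).2]
    simp only [loss]
    omega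
  · obtain ⟨p, l, h⟩ := (F.pend s i).exists_trace
    have hl := h.ncard_verts
    have h1 := h.one_le
    refine ⟨_, isFlexible_piece_path X (F.pend s i), ?_⟩
    rw [hinner ⟨s, .inr i⟩ ((h.mem_verts _).2 ⟨0, by omega, h.start⟩)]
    simp only [loss]
    split_ifs <;> omega

theorem sum_loss (X : Finset Bool) :
    ∑ i : Option (Σ s, Fin (α s) ⊕ Fin (β s)), loss X i =
      (if X = Finset.univ then 2 else 0) + (α true + if true ∈ X then β true else 0) +
        (α false + if false ∈ X then β false else 0) := by
  simp [Fintype.sum_option, Fintype.sum_sigma, loss, add_assoc]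

theorem hasOrthRep [Fintype V] (F : IsPulsarFamily G w α β P) (X : Finset Bool) {r s : ℕ}
    (hrs : Fintype.card V ≤ r + s + ∑ i : Option (Σ s, Fin (α s) ⊕ Fin (β s)), loss X i + 2) :
    HasOrthRep G (r + X.card) (s + X.card) := by
  choose m hm hle using F.exists_isFlexible_piece X
  apply hasOrthRep_of_isolate (w := w)
  refine IsFlexible.of_iSup (fun a b => ?_) hm (fun i j hij a b hi hj => ?_) r s ?_
  · constructor
    · rintro ⟨h1, h2⟩
      obtain ⟨i, hi⟩ := (F.adj_iff a b).1 h1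
      exact ⟨i, hi, h2⟩
    · rintro ⟨i, hi, h2⟩
      exact ⟨(F.adj_iff a b).2 ⟨i, hi⟩, h2⟩
  · exact F.not_adj_of_adj hij hi.1 hj.1
  · have h1 := Finset.sum_le_sum fun i (_ : i ∈ Finset.univ) => hle i
    rw [Finset.sum_add_distrib] at h1
    have h2 := F.sum_inner_le
    omega

end IsPulsarFamily

/-! ### The inertia table of a pulsar -/

theorem theorem5p1 {V : Type*} [Fintype V] [DecidableEq V] (G : SimpleGraph V)
    (n α₁ β₁ α₂ β₂ : ℕ) (hn : Fintype.card V = n) (hG : IsPulsar G α₁ β₁ α₂ β₂) :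
    inertiaTable G =
      trapezoid 0 ((n : ℤ) - α₁ - α₂ - 2) n ∪
      trapezoid 1 ((n : ℤ) - α₁ - α₂ - β₁) n ∪
      trapezoid 1 ((n : ℤ) - α₁ - α₂ - β₂) n ∪
      trapezoid 2 ((n : ℤ) - α₁ - α₂ - β₁ - β₂) n := by
  subst hn
  obtain ⟨w, P, F⟩ := hG.exists_family
  ext ⟨r, s⟩
  simp only [trapezoid, Set.mem_union, Set.mem_ofPred_eq]
  constructor
  · rintro ⟨A, hA, hGA, h⟩
    obtain ⟨rfl, rfl⟩ := Prod.mk.inj h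
    obtain ⟨D⟩ := F.nonempty_armSystem hGA
    have hdim := finrank_ker_add_eigenvalueCounts hA
    have hκ : Fintype.card (Σ s : Bool, Fin (cond s α₁ α₂)) = α₁ + α₂ := by simp
    by_cases hsing : ∃ s i, IsSingularOn A (D.pend s i)
    · obtain ⟨s, i, hs⟩ := hsing
      have h1 := D.nullity_of_singular_pend hA hs
      rw [hκ] at h1
      cases s <;> simp only [Bool.not_true, Bool.not_false, cond_true, cond_false] at h1 <;> omega
    · push Not at hsing
      have h1 := D.finrank_ker_le_of_nonsingular
        (by simpa [Matrix.IsHermitian, Matrix.IsSymm] using hA) hsing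
      rw [hκ] at h1
      omega
  -- the four trapezoids come from isolating none, one or both of the centers
  · have key : ∀ X : Finset Bool, X.card ≤ r → X.card ≤ s → r + s ≤ Fintype.card V →
        Fintype.card V + 2 * X.card ≤ r + s + ((if X = Finset.univ then 2 else 0) +
          (α₁ + if true ∈ X then β₁ else 0) + (α₂ + if false ∈ X then β₂ else 0)) + 2 →
        (r, s) ∈ inertiaTable G := by
      intro X hr hs hle h
      have h1 := F.hasOrthRep X (r := r - X.card) (s := s - X.card) (by
        rw [IsPulsarFamily.sum_loss]
        simp only [cond_true, cond_false]
        omega)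
      rw [Nat.sub_add_cancel hr, Nat.sub_add_cancel hs] at h1
      exact h1.mem_inertiaTable hle
    rintro (((h | h) | h) | h)
    · exact key ∅ (by simp) (by simp) (by omega) (by
        rw [if_neg (by decide), if_neg (by decide), if_neg (by decide), Finset.card_empty]; omega)
    · exact key {true} (by simpa using h.1) (by simpa using h.2.1) (by omega) (by
        rw [if_neg (by decide), if_pos (by decide), if_neg (by decide), Finset.card_singleton]
        omega)
    · exact key {false} (by simpa using h.1) (by simpa using h.2.1) (by omega) (by
        rw [if_neg (by decide), if_neg (by decide), if_pos (by decide), Finset.card_singleton]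
        omega)
    · exact key Finset.univ (by simpa using h.1) (by simpa using h.2.1) (by omega) (by
        rw [if_pos rfl, if_pos (by decide), if_pos (by decide), Finset.card_univ,
          Fintype.card_bool]
        omega)
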